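/- Let $d\in\mathbb N$, $\eta>0$, $0<\mu_f\le L_f$, $0<\mu_\phi\le L_\phi$. For $0\le\mu\le L$ let $S(\mu,L)$ be the set of continuously differentiable $h:\mathbb R^d\to\mathbb R$ with $\mu\|x-y\|^2\le(\nabla h(x)-\nabla h(y))^T(x-y)\le L\|x-y\|^2$ for all $x,y$. Let $f\in S(\mu_f,L_f)$, $\phi\in S(\mu_\phi,L_\phi)$, let $\bar\phi(z)=\sup_x\{x^Tz-\phi(x)\}$ be the convex conjugate of $\phi$, and put $\mu_{\bar\phi}=1/L_\phi$. Then $f$ has a unique minimizer $x^{\rm opt}$, and the continuous-time mirror descent flow $\dot z=-\eta\,\nabla f(\nabla\bar\phi(z))$ has a unique equilibrium $z^{\rm opt}$, with $\nabla\bar\phi(z^{\rm opt})=x^{\rm opt}$. Let $G$ be the causal linear time-invariant operator with transfer function $$G(s)=\frac{1}{s+\eta\mu_f\mu_{\bar\phi}}\begin{bmatrix}-\eta\mu_{\bar\phi}&s\\-\eta&-\eta\mu_f\end{bmatrix}\otimes I_d ,$$ and let $\Delta$ be the nonlinearity $\Delta(v)=(\Delta_1(v_1),\Delta_2(v_2))$,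 acting pointwise in time on signals $v=(v_1,v_2)$ with values in $\mathbb R^d\times\mathbb R^d$, where $$\Delta_1(x)=\big(\nabla f(x+x^{\rm opt})-\mu_f(x+x^{\rm opt})\big)-\big(\nabla f(x^{\rm opt})-\mu_fx^{\rm opt}\big),$$ $$\Delta_2(x)=\big(\nabla\bar\phi(x+z^{\rm opt})-\mu_{\bar\phi}(x+z^{\rm opt})\big)-\big(\nabla\bar\phi(z^{\rm opt})-\mu_{\bar\phi}z^{\rm opt}\big).$$ Let $\mathbf L_{2e}[0,\infty)$ be the space of signals that are square integrable on finite intervals. (1) The interconnection $v=Gw+g$, $w=\Delta(v)+e$ is stable: $G$ and $\Delta$ are causal operators on $\mathbf L_{2e}[0,\infty)$, the map $(v,w)\mapsto(e,g)$ has a causal inverse on $\mathbf L_{2e}[0,\infty)$, and there is a constant $c>0$ with $\int_0^T(|v|^2+|w|^2)\,dt\le c\int_0^T(|g|^2+|e|^2)\,dt$ for all $T\ge0$ and all $e,g\in\mathbf L_{2e}[0,\infty)$. In particular $v,w\in\mathbf L_2[0,\infty)$ whenever $e,g\in\mathbf L_2[0,\infty)$. (2) For every $z_0\in\mathbb R^d$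 the flow has a solution on $[0,\infty)$ with $z(0)=z_0$, and along every solution $x(t)=\nabla\bar\phi(z(t))\to x^{\rm opt}$ as $t\to\infty$. -/

import Mathlib

open MeasureTheory Set Filter Topology

noncomputable section

namespace MirrorDescent

/-- The Euclidean space `ℝ^d`. -/
abbrev Vec (d : ℕ) : Type := EuclideanSpace ℝ (Fin d)

/-- The space `ℝ^d × ℝ^d = ℝ^(2d)` of stacked vectors, with the Euclidean norm. -/
abbrev Vec2 (d : ℕ) : Type := EuclideanSpace ℝ (Fin d ⊕ Fin d)

/-- Upper half of a stacked vector. -/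
def upper {d : ℕ} (v : Vec2 d) : Vec d := WithLp.toLp 2 (fun i => v (Sum.inl i))

/-- Lower half of a stacked vector. -/
def lower {d : ℕ} (v : Vec2 d) : Vec d := WithLp.toLp 2 (fun i => v (Sum.inr i))

/-- The stacked vector with upper half `a` and lower half `b`. -/
def stack {d : ℕ} (a b : Vec d) : Vec2 d := WithLp.toLp 2 (Sum.elim a b)

/-! ### Functions -/

/-- The class `S(μ, L)`: continuously differentiable, `μ`-strongly convex, `L`-smooth functions. -/
def classS {d : ℕ} (μ L : ℝ) : Set (Vec d → ℝ) :=
  {f | ContDiff ℝ 1 f ∧ ∀ x y : Vec d,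
    μ * ‖x - y‖ ^ 2 ≤ inner ℝ (gradient f x - gradient f y) (x - y) ∧
    inner ℝ (gradient f x - gradient f y) (x - y) ≤ L * ‖x - y‖ ^ 2}

/-- The convex conjugate `z ↦ sup_x (xᵀ z - φ x)`. -/
def conjugate {d : ℕ} (φ : Vec d → ℝ) (z : Vec d) : ℝ :=
  ⨆ x : Vec d, (inner ℝ x z - φ x)

/-! ### Signals and feedback interconnections

A signal on `[0, ∞)` is represented by a function on `ℝ`, of which only the values at `t ≥ 0`
matter; signals are identified when they agree almost everywhere. -/

/-- The space `L₂[0, ∞)`. -/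
def L2 (E : Type*) [NormedAddCommGroup E] : Set (ℝ → E) :=
  {u | MemLp u 2 (volume.restrict (Ici 0))}

/-- The extended space `L₂ₑ[0, ∞)`: signals that are square integrable on finite intervals. -/
def L2e (E : Type*) [NormedAddCommGroup E] : Set (ℝ → E) :=
  {u | ∀ T : ℝ, MemLp u 2 (volume.restrict (Icc 0 T))}

/-- Two signals agree almost everywhere on `[0, T]`, i.e. `P_T u = P_T u'`. -/
def AgreeUpTo {E : Type*} (T : ℝ) (u u' : ℝ → E) : Prop :=
  u =ᵐ[volume.restrict (Icc 0 T)] u'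

/-- `H` is a causal operator on `L₂ₑ`. The second clause is equivalent to
`P_T H P_T = P_T H` for operators on classes of almost everywhere equal signals; it also says
that `H` is well defined on these classes. -/
def IsCausal {E F : Type*} [NormedAddCommGroup E] [NormedAddCommGroup F]
    (H : (ℝ → E) → (ℝ → F)) : Prop :=
  (∀ u ∈ L2e E, H u ∈ L2e F) ∧
  ∀ T : ℝ, 0 ≤ T → ∀ u ∈ L2e E, ∀ u' ∈ L2e E, AgreeUpTo T u u' → AgreeUpTo T (H u) (H u')

/-- The interconnection equations `v = G w + g`, `w = Δ v + e` (almost everywhere on `[0, ∞)`),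
for signals in `L₂ₑ`. -/
structure Interconnected {E F : Type*} [NormedAddCommGroup E] [NormedAddCommGroup F]
    (G : (ℝ → F) → (ℝ → E)) (Δ : (ℝ → E) → (ℝ → F))
    (e : ℝ → F) (g : ℝ → E) (v : ℝ → E) (w : ℝ → F) : Prop where
  mem_v : v ∈ L2e E
  mem_w : w ∈ L2e F
  eq_v : v =ᵐ[volume.restrict (Ici 0)] G w + g
  eq_w : w =ᵐ[volume.restrict (Ici 0)] Δ v + e

/-- Well-posedness of the interconnection of the causal operators `G` and `Δ`: the map
`(v, w) ↦ (e, g)` has a causal inverse on `L₂ₑ`. The last clause, for all `T`, contains the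
uniqueness of `(v, w)` for given `(e, g)` as well as the causality of the inverse. -/
structure WellPosed {E F : Type*} [NormedAddCommGroup E] [NormedAddCommGroup F]
    (G : (ℝ → F) → (ℝ → E)) (Δ : (ℝ → E) → (ℝ → F)) : Prop where
  causal_G : IsCausal G
  causal_Δ : IsCausal Δ
  exists_solution : ∀ e ∈ L2e F, ∀ g ∈ L2e E, ∃ v w, Interconnected G Δ e g v w
  causal_inverse : ∀ T : ℝ, 0 ≤ T → ∀ e ∈ L2e F, ∀ e' ∈ L2e F, ∀ g ∈ L2e E, ∀ g' ∈ L2e E,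
    ∀ v w v' w', Interconnected G Δ e g v w → Interconnected G Δ e' g' v' w' →
    AgreeUpTo T e e' → AgreeUpTo T g g' → AgreeUpTo T v v' ∧ AgreeUpTo T w w'

/-- Stability of the interconnection: it is well-posed and the inverse is bounded. -/
def IsStable {E F : Type*} [NormedAddCommGroup E] [NormedAddCommGroup F]
    (G : (ℝ → F) → (ℝ → E)) (Δ : (ℝ → E) → (ℝ → F)) : Prop :=
  WellPosed G Δ ∧
  ∃ c : ℝ, 0 < c ∧ ∀ e ∈ L2e F, ∀ g ∈ L2e E, ∀ v w, Interconnected G Δ e g v w →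
    ∀ T : ℝ, 0 ≤ T →
      ∫ t in (0 : ℝ)..T, (‖v t‖ ^ 2 + ‖w t‖ ^ 2) ≤
        c * ∫ t in (0 : ℝ)..T, (‖g t‖ ^ 2 + ‖e t‖ ^ 2)

/-! ### Linear time-invariant systems -/

section LTI

variable {n m l : Type*} [Fintype n] [DecidableEq n] [Fintype m] [Fintype l]

/-- The transfer function matrix `C (s I - A)⁻¹ B + D`. -/
def transferFunction (A : Matrix n n ℝ) (B : Matrix n m ℝ) (C : Matrix l n ℝ)
    (D : Matrix l m ℝ) (s : ℂ) : Matrix l m ℂ :=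
  C.map Complex.ofReal * (s • (1 : Matrix n n ℂ) - A.map Complex.ofReal)⁻¹ *
    B.map Complex.ofReal + D.map Complex.ofReal

/-- The input-output operator with the transfer function `C (s I - A)⁻¹ B + D`:
`(G w)(t) = ∫₀ᵗ C exp((t - s) A) B w(s) ds + D w(t)`, the output of `ż = A z + B w`,
`y = C z + D w` with zero initial state. -/
def ltiOperator (A : Matrix n n ℝ) (B : Matrix n m ℝ) (C : Matrix l n ℝ) (D : Matrix l m ℝ)
    (w : ℝ → EuclideanSpace ℝ m) (t : ℝ) : EuclideanSpace ℝ l :=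
  WithLp.toLp 2 ((∫ s in (0 : ℝ)..t,
      (C * NormedSpace.exp ((t - s) • A) * B).mulVec (w s).ofLp) + D.mulVec (w t).ofLp)

end LTI

/-! ### The mirror descent system -/

section System

variable (d : ℕ) (η μf μc : ℝ)

/-- System matrix `A`; `μc` is the strong convexity constant of the conjugate of `φ`. -/
def matA : Matrix (Fin d) (Fin d) ℝ := (-(η * μf * μc)) • 1

/-- System matrix `B = [-η I, -η μf I]`. -/
def matB : Matrix (Fin d) (Fin d ⊕ Fin d) ℝ := Matrix.fromCols ((-η) • 1) ((-(η * μf)) • 1)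

/-- System matrix `C = [μc I; I]`. -/
def matC : Matrix (Fin d ⊕ Fin d) (Fin d) ℝ := Matrix.fromRows (μc • 1) 1

/-- System matrix `D = [0, I; 0, 0]`. -/
def matD : Matrix (Fin d ⊕ Fin d) (Fin d ⊕ Fin d) ℝ := Matrix.fromBlocks 0 1 0 0

/-- The linear operator `G` of the mirror descent system. -/
def mdOperator : (ℝ → Vec2 d) → (ℝ → Vec2 d) :=
  ltiOperator (matA d η μf μc) (matB d η μf) (matC d μc) (matD d)

/-- The transfer function matrix of `mdOperator` is
`(s + η μf μc)⁻¹ [-η μc, s; -η, -η μf] ⊗ I_d`. -/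
theorem transferFunction_md (s : ℂ) (hs : s + η * μf * μc ≠ 0) :
    transferFunction (matA d η μf μc) (matB d η μf) (matC d μc) (matD d) s =
      (s + η * μf * μc)⁻¹ • Matrix.fromBlocks ((-(η * μc) : ℂ) • 1) (s • 1)
        ((-η : ℂ) • 1) ((-(η * μf) : ℂ) • 1) := by
  have hinv : (s • (1 : Matrix (Fin d) (Fin d) ℂ) - (matA d η μf μc).map Complex.ofReal)⁻¹
      = (s + η * μf * μc)⁻¹ • (1 : Matrix (Fin d) (Fin d) ℂ) := by
    apply Matrix.inv_eq_left_inv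
    have : (s • (1 : Matrix (Fin d) (Fin d) ℂ) - (matA d η μf μc).map Complex.ofReal)
        = (s + η * μf * μc) • (1 : Matrix (Fin d) (Fin d) ℂ) := by
      ext i j
      by_cases h : i = j <;> simp [matA, h]
    rw [this, Matrix.smul_mul, Matrix.one_mul, smul_smul, inv_mul_cancel₀ hs, one_smul]
  unfold transferFunction
  rw [hinv]
  ext i j
  rcases i with i | i <;> rcases j with j | j <;> by_cases h : i = j <;>
    simp [matB, matC, matD, Matrix.mul_apply, Matrix.one_apply, h,
      apply_ite Complex.ofReal] <;> field_simp <;> ring_nf <;> simp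

end System

/-- The memoryless map `x ↦ (∇h (x + y) - μ (x + y)) - (∇h y - μ y)`. -/
def shiftedGradient {d : ℕ} (h : Vec d → ℝ) (μ : ℝ) (y x : Vec d) : Vec d :=
  (gradient h (x + y) - μ • (x + y)) - (gradient h y - μ • y)

/-- The nonlinear operator `Δ = diag(Δ₁, Δ₂)` of the error system, acting pointwise in time, where
`Δ₁`, `Δ₂` are the shifted gradients of `f` at `x_opt` and of `φc` (the conjugate of `φ`) at
`z_opt`. -/
def mdNonlinearity {d : ℕ} (f φc : Vec d → ℝ) (μf μc : ℝ) (xopt zopt : Vec d)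
    (v : ℝ → Vec2 d) (t : ℝ) : Vec2 d :=
  stack (shiftedGradient f μf xopt (upper (v t))) (shiftedGradient φc μc zopt (lower (v t)))

/-- `z` is a trajectory on `[0, ∞)` of the mirror descent flow `ż = -η ∇f(∇φc(z))`. -/
def IsMDTrajectory {d : ℕ} (η : ℝ) (f φc : Vec d → ℝ) (z : ℝ → Vec d) : Prop :=
  ∀ t : ℝ, 0 ≤ t →
    HasDerivWithinAt z (-η • gradient f (gradient φc (z t))) (Ici 0) t

end MirrorDescent

end

/-!
Let `ψ` be the conjugate of `φ`, let `z` be the equilibrium and `x = ∇ ψ z`. Undoing the loop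
shifts, the unforced error `y` obeys `y' = -η (∇ f (q + x) - ∇ f x)` with `q = ∇ ψ (y + z) - ∇ ψ z`.
The Bregman divergence of `ψ` at `z` is a Lyapunov function with gradient `q`, so it decreases at
rate at least `η μ_f ‖q‖²`. The inputs perturb this vector field in a Lipschitz way, and Young's
inequality turns the decay into a dissipation inequality, hence an `L₂` gain. The algebraic loop
through the direct feedthrough is triangular and thus solved by an explicit Lipschitz map, which
reduces well-posedness to an integral equation with Lipschitz right-hand side; Picard iteration in
an exponentially weighted sup norm solves it globally. Without inputs the same estimate makes the
Bregman divergence decay exponentially, and `‖q‖²` is bounded by a multiple of it.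
-/

namespace MirrorDescent

open scoped Gradient RealInnerProductSpace NNReal

section StronglyMonotone

variable {E : Type*} [NormedAddCommGroup E] [InnerProductSpace ℝ E] {μ L : ℝ} {F : E → E}

/-- The operator `F` is `μ`-strongly monotone; for a gradient this is `μ`-strong convexity of the
potential. For `μ = 0` it is plain monotonicity. -/
def IsStronglyMonotone (μ : ℝ) (F : E → E) : Prop :=
  ∀ x y, μ * ‖x - y‖ ^ 2 ≤ ⟪F x - F y, x - y⟫

/-- The one-sided Lipschitz condition, the upper counterpart of `IsStronglyMonotone`; for a
gradient this is `L`-smoothness of the potential. -/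
def IsOneSidedLipschitz (L : ℝ) (F : E → E) : Prop :=
  ∀ x y, ⟪F x - F y, x - y⟫ ≤ L * ‖x - y‖ ^ 2

theorem IsStronglyMonotone.monotone (hF : IsStronglyMonotone μ F) (hμ : 0 ≤ μ) :
    IsStronglyMonotone 0 F := fun x y =>
  (mul_le_mul_of_nonneg_right hμ (sq_nonneg _)).trans (hF x y)

theorem IsStronglyMonotone.mul_norm_sub_le (hF : IsStronglyMonotone μ F) (x y : E) :
    μ * ‖x - y‖ ≤ ‖F x - F y‖ := by
  rcases (norm_nonneg (x - y)).eq_or_lt with h0 | hpos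
  · rw [← h0, mul_zero]
    exact norm_nonneg _
  · refine le_of_mul_le_mul_right ?_ hpos
    calc μ * ‖x - y‖ * ‖x - y‖ = μ * ‖x - y‖ ^ 2 := by ring
      _ ≤ ⟪F x - F y, x - y⟫ := hF x y
      _ ≤ ‖F x - F y‖ * ‖x - y‖ := real_inner_le_norm _ _

theorem IsStronglyMonotone.injective (hF : IsStronglyMonotone μ F) (hμ : 0 < μ) :
    Function.Injective F := fun x y hxy => by
  have hle := hF.mul_norm_sub_le x y
  rw [hxy, sub_self, norm_zero] at hle
  exact sub_eq_zero.1 (norm_le_zero_iff.1 (nonpos_of_mul_nonpos_right hle hμ))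

theorem IsStronglyMonotone.inner_neg_smul_sub_le {η : ℝ} (hF : IsStronglyMonotone μ F)
    (hη : 0 ≤ η) (q x : E) : ⟪q, -(η • (F (q + x) - F x))⟫ ≤ -(η * μ) * ‖q‖ ^ 2 := by
  have := hF (q + x) x
  rw [add_sub_cancel_right, real_inner_comm] at this
  rw [inner_neg_right, real_inner_smul_right]
  linarith [mul_le_mul_of_nonneg_left this hη]

end StronglyMonotone

section BregmanDivergence

variable {E : Type*} [NormedAddCommGroup E] [InnerProductSpace ℝ E] [CompleteSpace E]
  {μ L : ℝ} {h k : E → ℝ}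

/-- The Bregman divergence of `h`: the error at `x` of the first-order expansion of `h` at `y`. -/
noncomputable def bregmanDiv (h : E → ℝ) (x y : E) : ℝ :=
  h x - h y - ⟪∇ h y, x - y⟫

@[simp]
theorem bregmanDiv_self (h : E → ℝ) (x : E) : bregmanDiv h x x = 0 := by
  simp [bregmanDiv]

theorem bregmanDiv_eq_add (h : E → ℝ) (x y z : E) :
    bregmanDiv h z y = bregmanDiv h z x + bregmanDiv h x y + ⟪∇ h x - ∇ h y, z - x⟫ := by
  simp only [bregmanDiv, inner_sub_left, inner_sub_right]
  ring

theorem bregmanDiv_add_bregmanDiv_comm (h : E → ℝ) (x y : E) :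
    bregmanDiv h x y + bregmanDiv h y x = ⟪∇ h x - ∇ h y, x - y⟫ := by
  simp only [bregmanDiv, inner_sub_left, inner_sub_right]
  ring

theorem hasGradientAt_bregmanDiv (hh : Differentiable ℝ h) (x y : E) :
    HasGradientAt (bregmanDiv h · y) (∇ h x - ∇ h y) x := by
  rw [hasGradientAt_iff_hasFDerivAt, map_sub]
  have hlin : HasFDerivAt (fun x => ⟪∇ h y, x - y⟫) (InnerProductSpace.toDual ℝ E (∇ h y)) x :=
    (InnerProductSpace.toDual ℝ E (∇ h y)).hasFDerivAt.comp x ((hasFDerivAt_id x).sub_const y)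
  exact ((hh x).hasGradientAt.hasFDerivAt.sub_const (h y)).sub hlin

theorem hasDerivAt_bregmanDiv_add_smul (hh : Differentiable ℝ h) (y v : E) (t : ℝ) :
    HasDerivAt (fun t : ℝ => bregmanDiv h (y + t • v) y) ⟪∇ h (y + t • v) - ∇ h y, v⟫ t := by
  have hline : HasDerivAt (fun t : ℝ => y + t • v) v t := by
    simpa using ((hasDerivAt_id t).smul_const v).const_add y
  exact (hasGradientAt_bregmanDiv hh (y + t • v) y).hasFDerivAt.comp_hasDerivAt t hline

theorem bregmanDiv_le_bregmanDiv (hh : Differentiable ℝ h) (hk : Differentiable ℝ k)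
    (hle : ∀ x y, ⟪∇ h x - ∇ h y, x - y⟫ ≤ ⟪∇ k x - ∇ k y, x - y⟫) (x y : E) :
    bregmanDiv h x y ≤ bregmanDiv k x y := by
  let gap : ℝ → ℝ := fun t => bregmanDiv k (y + t • (x - y)) y - bregmanDiv h (y + t • (x - y)) y
  have hgap := fun t => (hasDerivAt_bregmanDiv_add_smul hk y (x - y) t).sub
    (hasDerivAt_bregmanDiv_add_smul hh y (x - y) t)
  have hmono : MonotoneOn gap (Icc 0 1) := by
    refine monotoneOn_of_deriv_nonneg (convex_Icc 0 1)
      (fun t _ => (hgap t).continuousAt.continuousWithinAt)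
      (fun t _ => (hgap t).differentiableAt.differentiableWithinAt) fun t ht => ?_
    rw [interior_Icc] at ht
    have hscaled := hle (y + t • (x - y)) y
    rw [add_sub_cancel_left, inner_smul_right, inner_smul_right] at hscaled
    exact (hgap t).deriv.symm ▸ sub_nonneg.2 (le_of_mul_le_mul_left hscaled ht.1)
  simpa [gap] using hmono (left_mem_Icc.2 zero_le_one) (right_mem_Icc.2 zero_le_one) zero_le_one

theorem hasGradientAt_half_mul_norm_sq (c : ℝ) (x : E) :
    HasGradientAt (fun x => c / 2 * ‖x‖ ^ 2) (c • x) x := by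
  rw [hasGradientAt_iff_hasFDerivAt]
  refine ((hasStrictFDerivAt_norm_sq x).hasFDerivAt.const_mul (c / 2)).congr_fderiv ?_
  ext v
  simp only [smul_apply, coe_innerSL_apply, nsmul_eq_mul, Nat.cast_ofNat, smul_eq_mul, map_smul,
    InnerProductSpace.toDual_apply_apply]
  ring

theorem bregmanDiv_half_mul_norm_sq (c : ℝ) (x y : E) :
    bregmanDiv (fun x => c / 2 * ‖x‖ ^ 2) x y = c / 2 * ‖x - y‖ ^ 2 := by
  rw [bregmanDiv, (hasGradientAt_half_mul_norm_sq c y).gradient, norm_sub_sq_real, inner_smul_left,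
    inner_sub_right, real_inner_self_eq_norm_sq, real_inner_comm]
  simp only [conj_trivial]
  ring

theorem inner_gradient_half_mul_norm_sq_sub (c : ℝ) (x y : E) :
    ⟪∇ (fun x : E => c / 2 * ‖x‖ ^ 2) x - ∇ (fun x : E => c / 2 * ‖x‖ ^ 2) y, x - y⟫
      = c * ‖x - y‖ ^ 2 := by
  rw [(hasGradientAt_half_mul_norm_sq c x).gradient, (hasGradientAt_half_mul_norm_sq c y).gradient,
    ← smul_sub, real_inner_smul_left, real_inner_self_eq_norm_sq]

theorem half_mul_norm_sub_sq_le_bregmanDiv (hh : Differentiable ℝ h)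
    (hμ : IsStronglyMonotone μ (∇ h)) (x y : E) : μ / 2 * ‖x - y‖ ^ 2 ≤ bregmanDiv h x y := by
  rw [← bregmanDiv_half_mul_norm_sq]
  refine bregmanDiv_le_bregmanDiv
    (fun x => (hasGradientAt_half_mul_norm_sq μ x).differentiableAt) hh (fun x y => ?_) x y
  rw [inner_gradient_half_mul_norm_sq_sub]
  exact hμ x y

theorem bregmanDiv_le_half_mul_norm_sub_sq (hh : Differentiable ℝ h)
    (hL : IsOneSidedLipschitz L (∇ h)) (x y : E) : bregmanDiv h x y ≤ L / 2 * ‖x - y‖ ^ 2 := by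
  rw [← bregmanDiv_half_mul_norm_sq]
  refine bregmanDiv_le_bregmanDiv hh
    (fun x => (hasGradientAt_half_mul_norm_sq L x).differentiableAt) (fun x y => ?_) x y
  rw [inner_gradient_half_mul_norm_sq_sub]
  exact hL x y

theorem bregmanDiv_nonneg (hh : Differentiable ℝ h) (hmono : IsStronglyMonotone 0 (∇ h))
    (x y : E) : 0 ≤ bregmanDiv h x y := by
  simpa using half_mul_norm_sub_sq_le_bregmanDiv hh hmono x y

theorem mul_bregmanDiv_le_norm_gradient_sub_sq (hh : Differentiable ℝ h) (hμ : 0 ≤ μ)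
    (hmono : IsStronglyMonotone μ (∇ h)) (x y : E) :
    μ * bregmanDiv h x y ≤ ‖∇ h x - ∇ h y‖ ^ 2 := by
  have hle : bregmanDiv h x y ≤ ‖∇ h x - ∇ h y‖ * ‖x - y‖ :=
    calc bregmanDiv h x y ≤ bregmanDiv h x y + bregmanDiv h y x :=
          le_add_of_nonneg_right (bregmanDiv_nonneg hh (hmono.monotone hμ) y x)
      _ = ⟪∇ h x - ∇ h y, x - y⟫ := bregmanDiv_add_bregmanDiv_comm h x y
      _ ≤ ‖∇ h x - ∇ h y‖ * ‖x - y‖ := real_inner_le_norm _ _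
  calc μ * bregmanDiv h x y ≤ μ * (‖∇ h x - ∇ h y‖ * ‖x - y‖) := by gcongr
    _ = ‖∇ h x - ∇ h y‖ * (μ * ‖x - y‖) := by ring
    _ ≤ ‖∇ h x - ∇ h y‖ * ‖∇ h x - ∇ h y‖ := by gcongr; exact hmono.mul_norm_sub_le x y
    _ = ‖∇ h x - ∇ h y‖ ^ 2 := (sq _).symm

-- Compare `bregmanDiv h · y ≥ 0` with its quadratic upper bound at the gradient step from `x`.
theorem norm_gradient_sub_sq_le_bregmanDiv (hL : 0 < L) (hh : Differentiable ℝ h)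
    (hmono : IsStronglyMonotone 0 (∇ h)) (hlip : IsOneSidedLipschitz L (∇ h)) (x y : E) :
    ‖∇ h x - ∇ h y‖ ^ 2 ≤ 2 * L * bregmanDiv h x y := by
  set g := ∇ h x - ∇ h y with hg
  have hstep : ‖x - L⁻¹ • g - x‖ ^ 2 = L⁻¹ ^ 2 * ‖g‖ ^ 2 := by
    rw [sub_sub_cancel_left, norm_neg, norm_smul, mul_pow, Real.norm_eq_abs, sq_abs]
  have hinner : ⟪g, x - L⁻¹ • g - x⟫ = -(L⁻¹ * ‖g‖ ^ 2) := by
    rw [sub_sub_cancel_left, inner_neg_right, real_inner_smul_right, real_inner_self_eq_norm_sq]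
  have hnonneg : 0 ≤ L / 2 * (L⁻¹ ^ 2 * ‖g‖ ^ 2) + bregmanDiv h x y - L⁻¹ * ‖g‖ ^ 2 :=
    calc 0 ≤ bregmanDiv h (x - L⁻¹ • g) y := bregmanDiv_nonneg hh hmono _ y
      _ = bregmanDiv h (x - L⁻¹ • g) x + bregmanDiv h x y - L⁻¹ * ‖g‖ ^ 2 := by
        rw [bregmanDiv_eq_add h x, ← hg, hinner, ← sub_eq_add_neg]
      _ ≤ _ := by
        rw [← hstep]
        gcongr
        exact bregmanDiv_le_half_mul_norm_sub_sq hh hlip _ x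
  have hmul := mul_nonneg (mul_pos two_pos hL).le hnonneg
  field_simp at hmul
  linarith

/-- The Baillon–Haddad theorem. -/
theorem norm_gradient_sub_sq_le_inner (hL : 0 < L) (hh : Differentiable ℝ h)
    (hmono : IsStronglyMonotone 0 (∇ h)) (hlip : IsOneSidedLipschitz L (∇ h)) (x y : E) :
    ‖∇ h x - ∇ h y‖ ^ 2 ≤ L * ⟪∇ h x - ∇ h y, x - y⟫ := by
  have hxy := norm_gradient_sub_sq_le_bregmanDiv hL hh hmono hlip x y
  have hyx := norm_gradient_sub_sq_le_bregmanDiv hL hh hmono hlip y x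
  rw [norm_sub_rev] at hyx
  rw [← bregmanDiv_add_bregmanDiv_comm]
  linarith

theorem lipschitzWith_gradient (hL : 0 < L) (hh : Differentiable ℝ h)
    (hmono : IsStronglyMonotone 0 (∇ h)) (hlip : IsOneSidedLipschitz L (∇ h)) :
    LipschitzWith L.toNNReal (∇ h) := by
  refine LipschitzWith.of_dist_le' fun x y => ?_
  rw [dist_eq_norm, dist_eq_norm]
  refine le_of_sq_le_sq ?_ (by positivity)
  calc ‖∇ h x - ∇ h y‖ ^ 2 ≤ L * ⟪∇ h x - ∇ h y, x - y⟫ :=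
        norm_gradient_sub_sq_le_inner hL hh hmono hlip x y
    _ ≤ L * (L * ‖x - y‖ ^ 2) := by gcongr; exact hlip x y
    _ = (L * ‖x - y‖) ^ 2 := by ring

theorem forall_le_iff_gradient_eq_zero (hh : Differentiable ℝ h)
    (hmono : IsStronglyMonotone 0 (∇ h)) (x : E) : (∀ y, h x ≤ h y) ↔ ∇ h x = 0 := by
  refine ⟨fun hx => ?_, fun hx y => ?_⟩
  · have hfderiv := IsLocalMin.hasFDerivAt_eq_zero (Eventually.of_forall hx)
      (hh x).hasGradientAt.hasFDerivAt
    exact (LinearIsometryEquiv.map_eq_zero_iff _).1 hfderiv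
  · simpa [bregmanDiv, hx] using bregmanDiv_nonneg hh hmono y x

theorem surjective_gradient [ProperSpace E] (hμ : 0 < μ) (hh : Differentiable ℝ h)
    (hmono : IsStronglyMonotone μ (∇ h)) : Function.Surjective (∇ h) := by
  intro z
  let k : E → ℝ := fun x => h x - ⟪z, x⟫
  have hgrad : ∀ x, HasGradientAt k (∇ h x - z) x := fun x => by
    rw [hasGradientAt_iff_hasFDerivAt, map_sub]
    exact (hh x).hasGradientAt.hasFDerivAt.sub (InnerProductSpace.toDual ℝ E z).hasFDerivAt
  have hk : Differentiable ℝ k := fun x => (hgrad x).differentiableAt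
  have hk_mono : IsStronglyMonotone μ (∇ k) := fun x y => by
    simpa only [(hgrad _).gradient, sub_sub_sub_cancel_right] using hmono x y
  have hlower : ∀ x, ‖x‖ * (μ / 2 * ‖x‖ - ‖∇ k 0‖) + k 0 ≤ k x := fun x => by
    have hbregman := half_mul_norm_sub_sq_le_bregmanDiv hk hk_mono x 0
    rw [bregmanDiv, sub_zero] at hbregman
    have hinner := neg_le_of_abs_le (abs_real_inner_le_norm (∇ k 0) x)
    linarith
  have hcoercive : Tendsto k (cocompact E) atTop := by
    have hnorm := tendsto_norm_cocompact_atTop (E := E)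
    refine tendsto_atTop_mono hlower (tendsto_atTop_add_const_right _ _ ?_)
    exact hnorm.atTop_mul_atTop₀
      (tendsto_atTop_add_const_right _ _ (hnorm.const_mul_atTop (by positivity)))
  obtain ⟨x, hx⟩ := hk.continuous.exists_forall_le hcoercive
  refine ⟨x, sub_eq_zero.1 ?_⟩
  rw [← (hgrad x).gradient]
  exact (forall_le_iff_gradient_eq_zero hk (hk_mono.monotone hμ.le) x).1 hx

end BregmanDivergence

section Conjugate

variable {d : ℕ} {μ L : ℝ} {h : Vec d → ℝ}

theorem conjugate_gradient (hh : Differentiable ℝ h) (hmono : IsStronglyMonotone 0 (∇ h))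
    (x : Vec d) : conjugate h (∇ h x) = ⟪x, ∇ h x⟫ - h x := by
  have hle : ∀ y, ⟪y, ∇ h x⟫ - h y ≤ ⟪x, ∇ h x⟫ - h x := fun y => by
    have hnonneg := bregmanDiv_nonneg hh hmono y x
    rw [bregmanDiv, inner_sub_right, real_inner_comm, real_inner_comm x] at hnonneg
    linarith
  exact IsGreatest.csSup_eq ⟨mem_range_self x, forall_mem_range.2 hle⟩

theorem conjugate_gradient_sub (hh : Differentiable ℝ h) (hmono : IsStronglyMonotone 0 (∇ h))
    (x y : Vec d) :
    conjugate h (∇ h y) - conjugate h (∇ h x) - ⟪x, ∇ h y - ∇ h x⟫ = bregmanDiv h x y := by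
  rw [conjugate_gradient hh hmono, conjugate_gradient hh hmono, bregmanDiv, inner_sub_right,
    inner_sub_right, real_inner_comm x, real_inner_comm y]
  ring

theorem hasGradientAt_conjugate (hh : Differentiable ℝ h) (hμ : 0 < μ)
    (hmono : IsStronglyMonotone μ (∇ h)) (x : Vec d) :
    HasGradientAt (conjugate h) x (∇ h x) := by
  rw [hasGradientAt_iff_isLittleO]
  have hquadratic : (fun z => conjugate h z - conjugate h (∇ h x) - ⟪x, z - ∇ h x⟫)
      =O[𝓝 (∇ h x)] fun z => ‖z - ∇ h x‖ ^ 2 := by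
    refine Asymptotics.IsBigO.of_bound μ⁻¹ (Eventually.of_forall fun z => ?_)
    obtain ⟨y, rfl⟩ := surjective_gradient hμ hh hmono z
    rw [conjugate_gradient_sub hh (hmono.monotone hμ.le), norm_pow, norm_norm,
      Real.norm_of_nonneg (bregmanDiv_nonneg hh (hmono.monotone hμ.le) x y), norm_sub_rev,
      le_inv_mul_iff₀ hμ]
    exact mul_bregmanDiv_le_norm_gradient_sub_sq hh hμ.le hmono x y
  exact hquadratic.trans_isLittleO (Asymptotics.isLittleO_pow_sub_sub _ one_lt_two)

theorem gradient_conjugate_gradient (hh : Differentiable ℝ h) (hμ : 0 < μ)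
    (hmono : IsStronglyMonotone μ (∇ h)) (x : Vec d) : ∇ (conjugate h) (∇ h x) = x :=
  (hasGradientAt_conjugate hh hμ hmono x).gradient

theorem gradient_gradient_conjugate (hh : Differentiable ℝ h) (hμ : 0 < μ)
    (hmono : IsStronglyMonotone μ (∇ h)) (z : Vec d) : ∇ h (∇ (conjugate h) z) = z := by
  obtain ⟨x, rfl⟩ := surjective_gradient hμ hh hmono z
  rw [gradient_conjugate_gradient hh hμ hmono]

theorem gradient_conjugate_eq_iff (hh : Differentiable ℝ h) (hμ : 0 < μ)
    (hmono : IsStronglyMonotone μ (∇ h)) {x z : Vec d} :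
    ∇ (conjugate h) z = x ↔ z = ∇ h x := by
  rw [← gradient_gradient_conjugate hh hμ hmono z, (hmono.injective hμ).eq_iff,
    gradient_gradient_conjugate hh hμ hmono]

theorem differentiable_conjugate (hh : Differentiable ℝ h) (hμ : 0 < μ)
    (hmono : IsStronglyMonotone μ (∇ h)) : Differentiable ℝ (conjugate h) := fun z => by
  obtain ⟨x, rfl⟩ := surjective_gradient hμ hh hmono z
  exact (hasGradientAt_conjugate hh hμ hmono x).differentiableAt

end Conjugate

section ClassS

variable {d : ℕ} {μ L : ℝ} {f : Vec d → ℝ}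

theorem classS.differentiable (hf : f ∈ classS μ L) : Differentiable ℝ f :=
  hf.1.differentiable one_ne_zero

theorem classS.isStronglyMonotone (hf : f ∈ classS μ L) : IsStronglyMonotone μ (∇ f) :=
  fun x y => (hf.2 x y).1

theorem classS.isOneSidedLipschitz (hf : f ∈ classS μ L) : IsOneSidedLipschitz L (∇ f) :=
  fun x y => (hf.2 x y).2

theorem classS.lipschitzWith_gradient (hf : f ∈ classS μ L) (hμ : 0 ≤ μ) (hL : 0 < L) :
    LipschitzWith L.toNNReal (∇ f) :=
  MirrorDescent.lipschitzWith_gradient hL (classS.differentiable hf)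
    ((classS.isStronglyMonotone hf).monotone hμ) (classS.isOneSidedLipschitz hf)

theorem classS.conjugate_mem (hf : f ∈ classS μ L) (hμ : 0 < μ) (hL : 0 < L) :
    conjugate f ∈ classS L⁻¹ μ⁻¹ := by
  have hdiff := classS.differentiable hf
  have hmono := classS.isStronglyMonotone hf
  have hinv := gradient_gradient_conjugate hdiff hμ hmono
  have hlip : ∀ x y, ‖∇ (conjugate f) x - ∇ (conjugate f) y‖ ≤ μ⁻¹ * ‖x - y‖ := fun x y => by
    rw [le_inv_mul_iff₀ hμ]
    simpa only [hinv] using hmono.mul_norm_sub_le (∇ (conjugate f) x) (∇ (conjugate f) y)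
  refine ⟨?_, fun x y => ⟨?_, ?_⟩⟩
  · rw [contDiff_one_iff_hasFDerivAt]
    refine ⟨fun z => InnerProductSpace.toDual ℝ (Vec d) (∇ (conjugate f) z), ?_,
      fun z => (differentiable_conjugate hdiff hμ hmono z).hasGradientAt.hasFDerivAt⟩
    exact (InnerProductSpace.toDual ℝ (Vec d)).continuous.comp
      (LipschitzWith.of_dist_le' fun x y => by simpa only [dist_eq_norm] using hlip x y).continuous
  · rw [inv_mul_le_iff₀ hL, real_inner_comm]
    simpa only [hinv] using norm_gradient_sub_sq_le_inner hL hdiff (hmono.monotone hμ.le)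
      (classS.isOneSidedLipschitz hf) (∇ (conjugate f) x) (∇ (conjugate f) y)
  · calc ⟪∇ (conjugate f) x - ∇ (conjugate f) y, x - y⟫
        ≤ ‖∇ (conjugate f) x - ∇ (conjugate f) y‖ * ‖x - y‖ := real_inner_le_norm _ _
      _ ≤ μ⁻¹ * ‖x - y‖ * ‖x - y‖ := by gcongr; exact hlip x y
      _ = μ⁻¹ * ‖x - y‖ ^ 2 := by ring

end ClassS

section AbsolutelyContinuous

theorem absolutelyContinuousOnInterval_of_dist_le {X Y : Type*} [PseudoMetricSpace X]
    [PseudoMetricSpace Y] {f : ℝ → X} {g : ℝ → Y} {a b K : ℝ}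
    (hg : AbsolutelyContinuousOnInterval g a b)
    (h : ∀ x ∈ uIcc a b, ∀ y ∈ uIcc a b, dist (f x) (f y) ≤ K * dist (g x) (g y)) :
    AbsolutelyContinuousOnInterval f a b := by
  have hKg := Tendsto.const_mul K hg
  rw [mul_zero] at hKg
  refine squeeze_zero' (Eventually.of_forall fun I => Finset.sum_nonneg fun i _ => dist_nonneg) ?_
    hKg
  filter_upwards [mem_inf_of_right (mem_principal_self _)] with I hI
  rw [Finset.mul_sum]
  exact Finset.sum_le_sum fun i hi => h _ (hI.1 i hi).1 _ (hI.1 i hi).2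

variable {E : Type*} [NormedAddCommGroup E] {T : ℝ}

theorem intervalIntegrable_of_mem_Icc {b : ℝ → E} (hb : IntervalIntegrable b volume 0 T) {t : ℝ}
    (ht : t ∈ Icc 0 T) : IntervalIntegrable b volume 0 t :=
  hb.mono_set (uIcc_subset_uIcc_left (Icc_subset_uIcc ht))

theorem absolutelyContinuousOnInterval_comp {V : E → ℝ} {u : ℝ → E} (hV : LocallyLipschitz V)
    (hu : AbsolutelyContinuousOnInterval u 0 T) :
    AbsolutelyContinuousOnInterval (fun t => V (u t)) 0 T := by
  obtain ⟨K, hK⟩ := (hV.locallyLipschitzOn (s := u '' uIcc 0 T)).exists_lipschitzOnWith_of_compact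
    (isCompact_uIcc.image_of_continuousOn hu.continuousOn)
  exact absolutelyContinuousOnInterval_of_dist_le hu fun x hx y hy =>
    hK.dist_le_mul _ (mem_image_of_mem u hx) _ (mem_image_of_mem u hy)

variable [NormedSpace ℝ E]

theorem absolutelyContinuousOnInterval_primitive {b : ℝ → E} (hT : 0 ≤ T)
    (hb : IntervalIntegrable b volume 0 T) :
    AbsolutelyContinuousOnInterval (fun t => ∫ s in (0 : ℝ)..t, b s) 0 T := by
  refine absolutelyContinuousOnInterval_of_dist_le (K := 1)
    (hb.norm.absolutelyContinuousOnInterval_intervalIntegral left_mem_uIcc) fun x hx y hy => ?_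
  rw [uIcc_of_le hT] at hx hy
  have hbx := intervalIntegrable_of_mem_Icc hb hx
  have hby := intervalIntegrable_of_mem_Icc hb hy
  rw [dist_eq_norm, dist_eq_norm, one_mul, intervalIntegral.integral_interval_sub_left hbx hby,
    intervalIntegral.integral_interval_sub_left hbx.norm hby.norm, Real.norm_eq_abs]
  exact intervalIntegral.norm_integral_le_abs_integral_norm

theorem sub_eq_integral_of_absolutelyContinuousOnInterval [CompleteSpace E] {u u' : ℝ → E}
    (hT : 0 ≤ T) (hu : AbsolutelyContinuousOnInterval u 0 T)
    (hu' : IntervalIntegrable u' volume 0 T)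
    (hderiv : ∀ᵐ t, t ∈ uIcc 0 T → HasDerivAt u (u' t) t) :
    u T - u 0 = ∫ s in (0 : ℝ)..T, u' s := by
  have hsub_deriv : ∀ᵐ t, t ∈ uIcc 0 T →
      HasDerivAt (u - fun t => ∫ s in (0 : ℝ)..t, u' s) 0 t := by
    filter_upwards [hderiv, hu'.ae_hasDerivAt_integral] with t htu htp ht
    simpa using (htu ht).sub (htp ht 0 left_mem_uIcc)
  obtain ⟨C, hC⟩ := (hu.sub
    (absolutelyContinuousOnInterval_primitive hT hu')).const_of_ae_hasDerivAt_zero hsub_deriv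
  have h0 := hC 0 left_mem_uIcc
  have hT' := hC T right_mem_uIcc
  simp only [Pi.sub_apply, intervalIntegral.integral_same, sub_zero] at h0 hT'
  rw [h0, ← hT', sub_sub_cancel]

theorem integral_le_add_integral_of_dissipation [CompleteSpace E] {V : E → ℝ} {u b : ℝ → E}
    {p q : ℝ → ℝ} (hT : 0 ≤ T) (hV : ContDiff ℝ 1 V) (hVT : 0 ≤ V (u T))
    (hb : IntervalIntegrable b volume 0 T)
    (hu : ∀ t ∈ Icc 0 T, u t = u 0 + ∫ s in (0 : ℝ)..t, b s)
    (hp : IntervalIntegrable p volume 0 T) (hq : IntervalIntegrable q volume 0 T)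
    (hdiss : ∀ᵐ t ∂volume.restrict (Icc 0 T), fderiv ℝ V (u t) (b t) ≤ q t - p t) :
    ∫ t in (0 : ℝ)..T, p t ≤ V (u 0) + ∫ t in (0 : ℝ)..T, q t := by
  let r : ℝ → E := fun t => u 0 + ∫ s in (0 : ℝ)..t, b s
  have hr : AbsolutelyContinuousOnInterval r 0 T :=
    absolutelyContinuousOnInterval_of_dist_le (K := 1)
      (absolutelyContinuousOnInterval_primitive hT hb) fun x _ y _ => by simp [r]
  have hVr := absolutelyContinuousOnInterval_comp hV.locallyLipschitz hr
  have hderiv_le : ∀ᵐ t ∂volume.restrict (Icc 0 T), deriv (fun t => V (r t)) t ≤ q t - p t := by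
    rw [ae_restrict_iff' measurableSet_Icc] at hdiss ⊢
    filter_upwards [hdiss, hb.ae_hasDerivAt_integral] with t htV htb ht
    have hrt : HasDerivAt r (b t) t :=
      (htb (Icc_subset_uIcc ht) 0 left_mem_uIcc).const_add (u 0)
    have hVrt : HasDerivAt (fun t => V (r t)) (fderiv ℝ V (r t) (b t)) t :=
      (hV.differentiable one_ne_zero (r t)).hasFDerivAt.comp_hasDerivAt t hrt
    rw [hVrt.deriv, show r t = u t from (hu t ht).symm]
    exact htV ht
  have hint := intervalIntegral.integral_mono_ae_restrict hT hVr.intervalIntegrable_deriv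
    (hq.sub hp) hderiv_le
  have hrT : r T = u T := (hu T (right_mem_Icc.2 hT)).symm
  rw [hVr.integral_deriv_eq_sub, intervalIntegral.integral_sub hq hp, hrT,
    show r 0 = u 0 by simp [r]] at hint
  linarith

end AbsolutelyContinuous

section IntegralEquation

variable {E : Type*} [NormedAddCommGroup E] [NormedSpace ℝ E]

theorem eq_zero_of_le_mul_integral {f : ℝ → ℝ} {T K : ℝ} (hf : ContinuousOn f (Icc 0 T))
    (hf0 : ∀ t ∈ Icc 0 T, 0 ≤ f t)
    (hle : ∀ t ∈ Icc 0 T, f t ≤ K * ∫ s in (0 : ℝ)..t, f s) {t : ℝ} (ht : t ∈ Icc 0 T) :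
    f t = 0 := by
  have hT : 0 ≤ T := ht.1.trans ht.2
  have hfi : IntervalIntegrable f volume 0 T := by
    rw [← uIcc_of_le hT] at hf
    exact hf.intervalIntegrable
  have hF0 : ∀ t ∈ Icc 0 T, 0 ≤ ∫ s in (0 : ℝ)..t, f s := fun t ht =>
    intervalIntegral.integral_nonneg ht.1 fun s hs => hf0 s ⟨hs.1, hs.2.trans ht.2⟩
  have hFc : ContinuousOn (fun t => ∫ s in (0 : ℝ)..t, f s) (Icc 0 T) := by
    simpa [uIcc_of_le hT] using intervalIntegral.continuousOn_primitive_interval' hfi left_mem_uIcc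
  have hF : ∀ t ∈ Icc 0 T, ∫ s in (0 : ℝ)..t, f s = 0 := by
    refine eq_zero_of_abs_deriv_le_mul_abs_self_of_eq_zero_right (f' := f) (K := K) hFc
      (fun t ht => ?_) intervalIntegral.integral_same fun t ht => ?_
    · have hcont : ContinuousWithinAt f (Icc t T) t :=
        (hf t (Ico_subset_Icc_self ht)).mono (Icc_subset_Icc_left ht.1)
      have : Fact (t ∈ Icc t T) := ⟨left_mem_Icc.2 ht.2.le⟩
      have hderiv : HasDerivWithinAt (fun t => ∫ s in (0 : ℝ)..t, f s) (f t) (Icc t T) t :=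
        intervalIntegral.integral_hasDerivWithinAt_right
          (intervalIntegrable_of_mem_Icc hfi (Ico_subset_Icc_self ht))
          ((hf.mono (Icc_subset_Icc_left ht.1)).stronglyMeasurableAtFilter_nhdsWithin
            measurableSet_Icc t) hcont
      exact hderiv.mono_of_mem_nhdsWithin (Icc_mem_nhdsGE ht.2)
    · have htI := Ico_subset_Icc_self ht
      rw [Real.norm_of_nonneg (hf0 t htI), Real.norm_of_nonneg (hF0 t htI)]
      exact hle t htI
  refine le_antisymm ?_ (hf0 t ht)
  simpa [hF t ht] using hle t ht

theorem eq_of_integral_eq {u u' b b' : ℝ → E} {c : E} {T K : ℝ}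
    (hu : ContinuousOn u (Icc 0 T)) (hu' : ContinuousOn u' (Icc 0 T))
    (hb : IntervalIntegrable b volume 0 T) (hb' : IntervalIntegrable b' volume 0 T)
    (hub : ∀ t ∈ Icc 0 T, u t = c + ∫ s in (0 : ℝ)..t, b s)
    (hub' : ∀ t ∈ Icc 0 T, u' t = c + ∫ s in (0 : ℝ)..t, b' s)
    (hlip : ∀ᵐ t ∂volume.restrict (Icc 0 T), ‖b t - b' t‖ ≤ K * ‖u t - u' t‖) :
    ∀ t ∈ Icc 0 T, u t = u' t := by
  have hcont : ContinuousOn (fun t => ‖u t - u' t‖) (Icc 0 T) := (hu.sub hu').norm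
  intro t ht
  refine sub_eq_zero.1 (norm_eq_zero.1 (eq_zero_of_le_mul_integral hcont
    (fun _ _ => norm_nonneg _) (K := K) (fun t ht => ?_) ht))
  rw [hub t ht, hub' t ht, add_sub_add_left_eq_sub,
    ← intervalIntegral.integral_sub (intervalIntegrable_of_mem_Icc hb ht)
      (intervalIntegrable_of_mem_Icc hb' ht), ← intervalIntegral.integral_const_mul]
  refine intervalIntegral.norm_integral_le_of_norm_le ht.1 ?_ ?_
  · filter_upwards [(ae_restrict_iff' measurableSet_Icc).1 hlip] with s hs hst
    exact hs ⟨hst.1.le, hst.2.trans ht.2⟩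
  · refine ContinuousOn.intervalIntegrable ((hcont.mono ?_).const_mul K |>.congr fun _ _ => rfl)
    rw [uIcc_of_le ht.1]
    exact Icc_subset_Icc_right ht.2

end IntegralEquation

section GlobalExistence

variable {E : Type*} [NormedAddCommGroup E] [NormedSpace ℝ E]

theorem exists_fixedPoint_of_weighted_contraction [CompleteSpace E] {X : Type*}
    [TopologicalSpace X] {ρ : X → ℝ} (hρ : Continuous ρ) (hρ0 : ∀ t, 0 < ρ t)
    {P : (X → E) → X → E} (hP : ∀ u, Continuous u → Continuous (P u)) {C : ℝ}
    (hP0 : ∀ t, ‖P 0 t‖ ≤ C * ρ t) {K : ℝ≥0} (hK : K < 1)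
    (hcontr : ∀ (u v : X → E) (M : ℝ), Continuous u → Continuous v →
      (∀ t, ‖u t - v t‖ ≤ M * ρ t) → ∀ t, ‖P u t - P v t‖ ≤ K * M * ρ t) :
    ∃ u, Continuous u ∧ P u = u := by
  have hcont (y : BoundedContinuousFunction X E) : Continuous fun t => ρ t • y t :=
    hρ.smul y.continuous
  have hscaled (y y' : BoundedContinuousFunction X E) (t : X) :
      ‖P (fun t => ρ t • y t) t - P (fun t => ρ t • y' t) t‖ ≤ K * dist y y' * ρ t := by
    refine hcontr _ _ _ (hcont y) (hcont y') (fun s => ?_) t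
    rw [← smul_sub, norm_smul, Real.norm_of_nonneg (hρ0 s).le, mul_comm, ← dist_eq_norm]
    exact mul_le_mul_of_nonneg_right (y.dist_coe_le_dist s) (hρ0 s).le
  have hbound (y : BoundedContinuousFunction X E) (t : X) :
      ‖(ρ t)⁻¹ • P (fun t => ρ t • y t) t‖ ≤ K * dist y 0 + C := by
    rw [norm_smul, norm_inv, Real.norm_of_nonneg (hρ0 t).le, inv_mul_le_iff₀' (hρ0 t), add_mul]
    have hdist := hscaled y 0 t
    simp only [BoundedContinuousFunction.coe_zero, Pi.zero_apply, smul_zero] at hdist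
    exact (norm_le_norm_sub_add _ _).trans (add_le_add hdist (hP0 t))
  let Q (y : BoundedContinuousFunction X E) : BoundedContinuousFunction X E :=
    .ofNormedAddCommGroup (fun t => (ρ t)⁻¹ • P (fun t => ρ t • y t) t)
      ((hρ.inv₀ fun t => (hρ0 t).ne').smul (hP _ (hcont y))) _ (hbound y)
  have hQ : ContractingWith K Q := by
    refine ⟨hK, LipschitzWith.of_dist_le_mul fun y y' =>
      (BoundedContinuousFunction.dist_le (by positivity)).2 fun t => ?_⟩
    rw [dist_eq_norm, BoundedContinuousFunction.coe_ofNormedAddCommGroup,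
      BoundedContinuousFunction.coe_ofNormedAddCommGroup, ← smul_sub, norm_smul, norm_inv,
      Real.norm_of_nonneg (hρ0 t).le, inv_mul_le_iff₀' (hρ0 t)]
    exact hscaled y y' t
  let y : BoundedContinuousFunction X E := hQ.fixedPoint
  have hy : ∀ t, (ρ t)⁻¹ • P (fun t => ρ t • y t) t = y t :=
    fun t => congrArg (fun y : BoundedContinuousFunction X E => y t) hQ.fixedPoint_isFixedPt
  exact ⟨fun t => ρ t • y t, hcont y, funext fun t => by
    rw [← hy t, smul_inv_smul₀ (hρ0 t).ne']⟩

theorem continuous_primitive_max {b : ℝ → E}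
    (hb : ∀ T, 0 ≤ T → IntervalIntegrable b volume 0 T) :
    Continuous fun t => ∫ s in (0 : ℝ)..max t 0, b s := by
  refine continuous_iff_continuousAt.2 fun t₀ => ?_
  have hT : (0 : ℝ) ≤ |t₀| + 1 := by positivity
  have hprim := intervalIntegral.continuousOn_primitive_interval' (hb _ hT) left_mem_uIcc
  rw [uIcc_of_le hT] at hprim
  have hmax : ContinuousOn (fun t => ∫ s in (0 : ℝ)..max t 0, b s) (Iic (|t₀| + 1)) :=
    hprim.comp (by fun_prop) fun t ht => ⟨le_max_right _ _, max_le ht hT⟩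
  exact hmax.continuousAt (Iic_mem_nhds (by linarith [le_abs_self t₀]))

theorem integral_exp_mul {r : ℝ} (hr : r ≠ 0) (t : ℝ) :
    ∫ s in (0 : ℝ)..t, Real.exp (r * s) = (Real.exp (r * t) - 1) / r := by
  rw [intervalIntegral.integral_comp_mul_left (fun x => Real.exp x) hr, integral_exp, mul_zero,
    Real.exp_zero, smul_eq_mul, inv_mul_eq_div]

/-- A weight of the form `exp (2Kt) (1 + ∫₀ᵗ a)`. -/
theorem exists_weight {K : ℝ} (hK : 0 < K) {a : ℝ → ℝ} (ha0 : ∀ s, 0 ≤ a s)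
    (ha : ∀ T, 0 ≤ T → IntervalIntegrable a volume 0 T) :
    ∃ ρ : ℝ → ℝ, Continuous ρ ∧ (∀ t, 1 ≤ ρ t) ∧
      (∀ t, ∫ s in (0 : ℝ)..max t 0, a s ≤ ρ t) ∧
      ∀ t, K * ∫ s in (0 : ℝ)..max t 0, ρ s ≤ ρ t / 2 := by
  let m : ℝ → ℝ := fun t => 1 + ∫ s in (0 : ℝ)..max t 0, a s
  have hint0 (t : ℝ) : 0 ≤ ∫ s in (0 : ℝ)..max t 0, a s :=
    intervalIntegral.integral_nonneg (le_max_right _ _) fun s _ => ha0 s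
  have hm1 (t : ℝ) : 1 ≤ m t := le_add_of_nonneg_right (hint0 t)
  have hmono {s t : ℝ} (hst : s ≤ t) : m s ≤ m t := by
    simp only [m]
    gcongr
    exact intervalIntegral.integral_mono_interval le_rfl (le_max_right _ _)
      (max_le_max_right 0 hst) (Eventually.of_forall ha0) (ha _ (le_max_right _ _))
  have hcont : Continuous fun t => Real.exp (2 * K * max t 0) * m t := by
    have := continuous_primitive_max ha
    fun_prop
  have hle (t : ℝ) : m t ≤ Real.exp (2 * K * max t 0) * m t :=
    le_mul_of_one_le_left (zero_le_one.trans (hm1 t)) (Real.one_le_exp (by positivity))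
  refine ⟨_, hcont, fun t => (hm1 t).trans (hle t),
    fun t => (le_add_of_nonneg_left zero_le_one).trans (hle t), fun t => ?_⟩
  have hτ : 0 ≤ max t 0 := le_max_right _ _
  calc K * ∫ s in (0 : ℝ)..max t 0, Real.exp (2 * K * max s 0) * m s
      ≤ K * ∫ s in (0 : ℝ)..max t 0, Real.exp (2 * K * s) * m t := by
        gcongr
        refine intervalIntegral.integral_mono_on hτ (hcont.intervalIntegrable _ _)
          (Continuous.intervalIntegrable (by fun_prop) _ _) fun s hs => ?_
        rw [max_eq_left hs.1]
        have hmax : m (max t 0) = m t := by simp only [m, max_eq_left hτ]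
        exact mul_le_mul_of_nonneg_left ((hmono hs.2).trans_eq hmax) (Real.exp_pos _).le
    _ = (Real.exp (2 * K * max t 0) - 1) * m t / 2 := by
        rw [intervalIntegral.integral_mul_const, integral_exp_mul (by positivity)]
        field_simp
    _ ≤ Real.exp (2 * K * max t 0) * m t / 2 := by linarith [hm1 t]

theorem exists_integral_eq [CompleteSpace E] {Φ : ℝ → E → E} {K : ℝ} (hK : 0 < K) (c : E)
    (hint : ∀ u : ℝ → E, Continuous u → ∀ T, 0 ≤ T →
      IntervalIntegrable (fun s => Φ s (u s)) volume 0 T)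
    (hlip : ∀ s x y, ‖Φ s x - Φ s y‖ ≤ K * ‖x - y‖) :
    ∃ u : ℝ → E, Continuous u ∧ ∀ t, 0 ≤ t → u t = c + ∫ s in (0 : ℝ)..t, Φ s (u s) := by
  have hint0 : ∀ T, 0 ≤ T → IntervalIntegrable (fun s => Φ s 0) volume 0 T :=
    hint 0 continuous_const
  obtain ⟨ρ, hρ, hρ1, hρa, hρK⟩ := exists_weight hK (a := fun s => ‖Φ s 0‖)
    (fun s => norm_nonneg _) fun T hT => (hint0 T hT).norm
  let P (u : ℝ → E) (t : ℝ) : E := c + ∫ s in (0 : ℝ)..max t 0, Φ s (u s)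
  have hP (u : ℝ → E) (hu : Continuous u) : Continuous (P u) :=
    continuous_const.add (continuous_primitive_max (hint u hu))
  have hP0 (t : ℝ) : ‖P 0 t‖ ≤ (‖c‖ + 1) * ρ t := by
    rw [add_one_mul]
    refine (norm_add_le _ _).trans (add_le_add (le_mul_of_one_le_right (norm_nonneg _) (hρ1 t)) ?_)
    exact (intervalIntegral.norm_integral_le_integral_norm (le_max_right _ _)).trans (hρa t)
  have hcontr (u v : ℝ → E) (M : ℝ) (hu : Continuous u) (hv : Continuous v)
      (huv : ∀ t, ‖u t - v t‖ ≤ M * ρ t) (t : ℝ) :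
      ‖P u t - P v t‖ ≤ (1 / 2 : ℝ≥0) * M * ρ t := by
    have hτ : 0 ≤ max t 0 := le_max_right _ _
    have hM : 0 ≤ M := nonneg_of_mul_nonneg_left ((norm_nonneg _).trans (huv 0))
      (zero_lt_one.trans_le (hρ1 0))
    have hdiff : ∀ s, ‖Φ s (u s) - Φ s (v s)‖ ≤ K * M * ρ s := fun s =>
      (hlip s _ _).trans ((mul_le_mul_of_nonneg_left (huv s) hK.le).trans_eq (mul_assoc ..).symm)
    rw [add_sub_add_left_eq_sub, ← intervalIntegral.integral_sub (hint u hu _ hτ) (hint v hv _ hτ)]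
    calc ‖∫ s in (0 : ℝ)..max t 0, (Φ s (u s) - Φ s (v s))‖
        ≤ ∫ s in (0 : ℝ)..max t 0, K * M * ρ s :=
          intervalIntegral.norm_integral_le_of_norm_le hτ
            (Eventually.of_forall fun s _ => hdiff s)
            (Continuous.intervalIntegrable (by fun_prop) _ _)
      _ = M * (K * ∫ s in (0 : ℝ)..max t 0, ρ s) := by
          rw [intervalIntegral.integral_const_mul]
          ring
      _ ≤ M * (ρ t / 2) := mul_le_mul_of_nonneg_left (hρK t) hM
      _ = (1 / 2 : ℝ≥0) * M * ρ t := by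
          push_cast
          ring
  obtain ⟨u, hu, hfix⟩ := exists_fixedPoint_of_weighted_contraction hρ
    (fun t => zero_lt_one.trans_le (hρ1 t)) hP hP0 (by norm_num) hcontr
  exact ⟨u, hu, fun t ht => by simpa [P, max_eq_left ht] using (congrFun hfix t).symm⟩

theorem exists_hasDerivWithinAt_of_lipschitzWith [CompleteSpace E] {Φ : E → E}
    {K : ℝ≥0} (hΦ : LipschitzWith K Φ) (z₀ : E) :
    ∃ z : ℝ → E, (∀ t, 0 ≤ t → HasDerivWithinAt z (Φ (z t)) (Ici 0) t) ∧ z 0 = z₀ := by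
  obtain ⟨z, hz, hint⟩ := exists_integral_eq (Φ := fun _ => Φ) (K := K + 1) (by positivity) z₀
    (fun u hu T _ => (hΦ.continuous.comp hu).intervalIntegrable 0 T)
    fun _ x y => (hΦ.norm_sub_le x y).trans (by gcongr; linarith)
  have hΦz : Continuous fun t => Φ (z t) := hΦ.continuous.comp hz
  refine ⟨z, fun t ht => ?_, by simpa using hint 0 le_rfl⟩
  have hderiv : HasDerivAt (fun t => z₀ + ∫ s in (0 : ℝ)..t, Φ (z s)) (Φ (z t)) t :=
    (hΦz.integral_hasStrictDerivAt 0 t).hasDerivAt.const_add z₀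
  exact hderiv.hasDerivWithinAt.congr hint (hint t ht)

end GlobalExistence

section Signals

variable {E F : Type*} [NormedAddCommGroup E] [NormedAddCommGroup F] {u v : ℝ → E} {T : ℝ}

theorem L2e.add (hu : u ∈ L2e E) (hv : v ∈ L2e E) : u + v ∈ L2e E :=
  fun T => (hu T).add (hv T)

theorem L2e.prodMk {w : ℝ → F} (hu : u ∈ L2e E) (hw : w ∈ L2e F) :
    (fun t => (u t, w t)) ∈ L2e (E × F) :=
  fun T => memLp_prod_iff.2 ⟨hu T, hw T⟩

theorem L2e.lipschitz_comp {N : E → F} {K : ℝ≥0} (hN : LipschitzWith K N) (hN0 : N 0 = 0)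
    (hu : u ∈ L2e E) : (fun t => N (u t)) ∈ L2e F :=
  fun T => hN.comp_memLp hN0 (hu T)

theorem L2e.clm_comp [NormedSpace ℝ E] [NormedSpace ℝ F] (A : E →L[ℝ] F) (hu : u ∈ L2e E) :
    (fun t => A (u t)) ∈ L2e F :=
  fun T => A.comp_memLp' (hu T)

theorem L2e.intervalIntegrable (hu : u ∈ L2e E) (hT : 0 ≤ T) :
    IntervalIntegrable u volume 0 T := by
  rw [intervalIntegrable_iff_integrableOn_Icc_of_le hT]
  exact (hu T).integrable one_le_two

theorem L2e.intervalIntegrable_norm_sq (hu : u ∈ L2e E) (hT : 0 ≤ T) :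
    IntervalIntegrable (fun t => ‖u t‖ ^ 2) volume 0 T := by
  rw [intervalIntegrable_iff_integrableOn_Icc_of_le hT]
  exact (memLp_two_iff_integrable_sq_norm (hu T).1).1 (hu T)

theorem L2e.of_continuousOn (hu : ∀ T, 0 ≤ T → ContinuousOn u (Icc 0 T)) : u ∈ L2e E := fun T => by
  rcases le_or_gt 0 T with hT | hT
  · obtain ⟨C, hC⟩ := isCompact_Icc.exists_bound_of_continuousOn (hu T hT)
    exact MemLp.of_bound ((hu T hT).aestronglyMeasurable_of_isCompact isCompact_Icc
      measurableSet_Icc) C (ae_restrict_of_forall_mem measurableSet_Icc hC)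
  · simp [Icc_eq_empty hT.not_ge]

theorem L2e.mem_L2 (hu : u ∈ L2e E) {C : ℝ}
    (hC : ∀ T, 0 ≤ T → ∫ t in (0 : ℝ)..T, ‖u t‖ ^ 2 ≤ C) : u ∈ L2 E := by
  have hunion : Ici (0 : ℝ) = ⋃ n : ℕ, Icc (0 : ℝ) n := by
    ext t
    simp only [mem_Ici, mem_iUnion, mem_Icc]
    exact ⟨fun h => (exists_nat_ge t).imp fun n hn => ⟨h, hn⟩, fun ⟨_, h⟩ => h.1⟩
  have hmeas : AEStronglyMeasurable u (volume.restrict (Ici 0)) := by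
    rw [hunion, aestronglyMeasurable_iUnion_iff]
    exact fun n => (hu n).1
  refine (memLp_two_iff_integrable_sq_norm hmeas).2 ?_
  rw [← IntegrableOn, integrableOn_Ici_iff_integrableOn_Ioi]
  refine integrableOn_Ioi_of_intervalIntegral_norm_bounded (l := atTop) (b := id) C 0
    (fun T => ?_) tendsto_id ?_
  · rcases le_or_gt 0 T with hT | hT
    · exact (intervalIntegrable_iff_integrableOn_Ioc_of_le hT).1
        (L2e.intervalIntegrable_norm_sq hu hT)
    · simp [Ioc_eq_empty hT.le.not_gt]
  · filter_upwards [eventually_ge_atTop 0] with T hT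
    simpa using hC T hT

theorem L2.mem_L2e (hu : u ∈ L2 E) : u ∈ L2e E :=
  fun _ => MemLp.mono_measure (Measure.restrict_mono Icc_subset_Ici_self le_rfl) hu

theorem L2.integral_norm_sq_le (hu : u ∈ L2 E) (hT : 0 ≤ T) :
    ∫ t in (0 : ℝ)..T, ‖u t‖ ^ 2 ≤ ∫ t in Ici 0, ‖u t‖ ^ 2 := by
  rw [intervalIntegral.integral_of_le hT]
  exact setIntegral_mono_set ((memLp_two_iff_integrable_sq_norm hu.1).1 hu)
    (Eventually.of_forall fun _ => by positivity)
    (Ioc_subset_Icc_self.trans Icc_subset_Ici_self).eventuallyLE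

theorem IsStable.mem_L2 {G : (ℝ → F) → ℝ → E} {Δ : (ℝ → E) → ℝ → F} (hstable : IsStable G Δ)
    {e : ℝ → F} {g : ℝ → E} (he : e ∈ L2 F) (hg : g ∈ L2 E) {v : ℝ → E} {w : ℝ → F}
    (hvw : Interconnected G Δ e g v w) : v ∈ L2 E ∧ w ∈ L2 F := by
  obtain ⟨-, c, hc, hgain⟩ := hstable
  have hint {T : ℝ} (hT : 0 ≤ T) := L2e.intervalIntegrable_norm_sq hvw.mem_v hT
  have hint' {T : ℝ} (hT : 0 ≤ T) := L2e.intervalIntegrable_norm_sq hvw.mem_w hT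
  have henergy (T : ℝ) (hT : 0 ≤ T) : ∫ t in (0 : ℝ)..T, (‖v t‖ ^ 2 + ‖w t‖ ^ 2) ≤
      c * ((∫ t in Ici 0, ‖g t‖ ^ 2) + ∫ t in Ici 0, ‖e t‖ ^ 2) := by
    refine (hgain e (L2.mem_L2e he) g (L2.mem_L2e hg) v w hvw T hT).trans
      (mul_le_mul_of_nonneg_left ?_ hc.le)
    rw [intervalIntegral.integral_add (L2e.intervalIntegrable_norm_sq (L2.mem_L2e hg) hT)
      (L2e.intervalIntegrable_norm_sq (L2.mem_L2e he) hT)]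
    exact add_le_add (L2.integral_norm_sq_le hg hT) (L2.integral_norm_sq_le he hT)
  constructor
  · refine L2e.mem_L2 hvw.mem_v fun T hT => le_trans ?_ (henergy T hT)
    exact intervalIntegral.integral_mono_on hT (hint hT) ((hint hT).add (hint' hT))
      fun t _ => le_add_of_nonneg_right (by positivity)
  · refine L2e.mem_L2 hvw.mem_w fun T hT => le_trans ?_ (henergy T hT)
    exact intervalIntegral.integral_mono_on hT (hint' hT) ((hint hT).add (hint' hT))
      fun t _ => le_add_of_nonneg_left (by positivity)

end Signals

section FirstOrder

variable {E : Type*} [NormedAddCommGroup E] [NormedSpace ℝ E]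

/-- The response `t ↦ ∫₀ᵗ exp(-α (t - s)) b(s) ds` of the first order system `ẏ = -α y + b` with
zero initial state. -/
noncomputable def expConv (α : ℝ) (b : ℝ → E) (t : ℝ) : E :=
  ∫ s in (0 : ℝ)..t, Real.exp (-(α * (t - s))) • b s

variable {α T : ℝ} {b : ℝ → E}

theorem expConv_eq_smul_integral (α : ℝ) (b : ℝ → E) :
    expConv α b = (fun t => Real.exp (-(α * t))) •
      fun t => ∫ s in (0 : ℝ)..t, Real.exp (α * s) • b s := by
  funext t
  rw [Pi.smul_apply', ← intervalIntegral.integral_smul]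
  refine intervalIntegral.integral_congr fun s _ => ?_
  rw [smul_smul, ← Real.exp_add]
  ring_nf

theorem expConv_congr {b' : ℝ → E} (h : AgreeUpTo T b b') :
    EqOn (expConv α b) (expConv α b') (Icc 0 T) := fun t ht => by
  refine intervalIntegral.integral_congr_ae ?_
  filter_upwards [(ae_restrict_iff' measurableSet_Icc).1 h] with s hs hst
  rw [uIoc_of_le ht.1] at hst
  rw [hs ⟨hst.1.le, hst.2.trans ht.2⟩]

theorem intervalIntegrable_exp_smul (hb : IntervalIntegrable b volume 0 T) :
    IntervalIntegrable (fun s => Real.exp (α * s) • b s) volume 0 T :=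
  hb.continuousOn_smul (by fun_prop)

theorem absolutelyContinuousOnInterval_expConv (hT : 0 ≤ T)
    (hb : IntervalIntegrable b volume 0 T) :
    AbsolutelyContinuousOnInterval (expConv α b) 0 T := by
  rw [expConv_eq_smul_integral]
  refine AbsolutelyContinuousOnInterval.smul (ContDiffOn.absolutelyContinuousOnInterval ?_)
    (absolutelyContinuousOnInterval_primitive hT (intervalIntegrable_exp_smul hb))
  fun_prop

theorem continuousOn_expConv (hT : 0 ≤ T) (hb : IntervalIntegrable b volume 0 T) :
    ContinuousOn (expConv α b) (Icc 0 T) := by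
  simpa [uIcc_of_le hT] using (absolutelyContinuousOnInterval_expConv (α := α) hT hb).continuousOn

theorem intervalIntegrable_neg_smul_add (hT : 0 ≤ T) (hb : IntervalIntegrable b volume 0 T)
    {y : ℝ → E} (hy : ContinuousOn y (Icc 0 T)) :
    IntervalIntegrable (fun s => -(α • y s) + b s) volume 0 T := by
  rw [← uIcc_of_le hT] at hy
  exact (hy.const_smul α).neg.intervalIntegrable.add hb

variable [CompleteSpace E]

theorem ae_hasDerivAt_expConv (hb : IntervalIntegrable b volume 0 T) :
    ∀ᵐ t, t ∈ uIcc 0 T → HasDerivAt (expConv α b) (-(α • expConv α b t) + b t) t := by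
  filter_upwards [(intervalIntegrable_exp_smul (α := α) hb).ae_hasDerivAt_integral] with t ht htT
  rw [expConv_eq_smul_integral]
  have hexp : HasDerivAt (fun t => Real.exp (-(α * t))) (Real.exp (-(α * t)) * -(α * 1)) t :=
    ((hasDerivAt_id t).const_mul α).neg.exp
  refine (hexp.smul (ht htT 0 left_mem_uIcc)).congr_deriv ?_
  rw [smul_smul, ← Real.exp_add, neg_add_cancel, Real.exp_zero, one_smul, Pi.smul_apply',
    smul_smul, add_comm, ← neg_smul]
  ring_nf

theorem expConv_eq_integral (hT : 0 ≤ T) (hb : IntervalIntegrable b volume 0 T) :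
    expConv α b T = ∫ s in (0 : ℝ)..T, (-(α • expConv α b s) + b s) := by
  rw [← sub_eq_integral_of_absolutelyContinuousOnInterval hT
    (absolutelyContinuousOnInterval_expConv hT hb)
    (intervalIntegrable_neg_smul_add hT hb (continuousOn_expConv hT hb))
    (ae_hasDerivAt_expConv hb)]
  simp [expConv]

theorem eq_expConv (hb : IntervalIntegrable b volume 0 T) {y : ℝ → E}
    (hy : ContinuousOn y (Icc 0 T))
    (hyb : ∀ t ∈ Icc 0 T, y t = ∫ s in (0 : ℝ)..t, (-(α • y s) + b s)) {t : ℝ}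
    (ht : t ∈ Icc 0 T) : y t = expConv α b t := by
  have hT : 0 ≤ T := ht.1.trans ht.2
  refine eq_of_integral_eq (c := 0) (K := |α|) hy (continuousOn_expConv hT hb)
    (intervalIntegrable_neg_smul_add hT hb hy)
    (intervalIntegrable_neg_smul_add hT hb (continuousOn_expConv hT hb))
    (fun t ht => (hyb t ht).trans (zero_add _).symm)
    (fun t ht => (expConv_eq_integral ht.1 (intervalIntegrable_of_mem_Icc hb ht)).trans
      (zero_add _).symm) (Eventually.of_forall fun t => ?_) t ht
  rw [add_sub_add_right_eq_sub, neg_sub_neg, ← smul_sub, norm_smul, Real.norm_eq_abs,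
    norm_sub_rev]

end FirstOrder

section FirstOrderOperator

variable {E V W : Type*} [NormedAddCommGroup E] [NormedSpace ℝ E] [NormedAddCommGroup V]
  [NormedSpace ℝ V] [NormedAddCommGroup W] [NormedSpace ℝ W]
  {α : ℝ} {A : E →L[ℝ] V} {B : W →L[ℝ] E} {D : W →L[ℝ] V}

/-- The state of `firstOrderOperator`: the solution of `ẏ = -α y + B w`, `y(0) = 0`. -/
noncomputable def firstOrderState (α : ℝ) (B : W →L[ℝ] E) (w : ℝ → W) : ℝ → E :=
  expConv α fun s => B (w s)

/-- The linear time-invariant system `ẏ = -α y + B w`, `v = A y + D w` with zero initial state.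
Only the scalar dynamics `-α` is allowed, as in the transfer function of the error system. -/
noncomputable def firstOrderOperator (α : ℝ) (A : E →L[ℝ] V) (B : W →L[ℝ] E) (D : W →L[ℝ] V)
    (w : ℝ → W) (t : ℝ) : V :=
  A (firstOrderState α B w t) + D (w t)

theorem intervalIntegrable_clm_comp {w : ℝ → W} (hw : w ∈ L2e W) {T : ℝ} (hT : 0 ≤ T) :
    IntervalIntegrable (fun s => B (w s)) volume 0 T :=
  L2e.intervalIntegrable (L2e.clm_comp B hw) hT

theorem continuousOn_firstOrderState {w : ℝ → W} (hw : w ∈ L2e W) {T : ℝ} (hT : 0 ≤ T) :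
    ContinuousOn (firstOrderState α B w) (Icc 0 T) :=
  continuousOn_expConv hT (intervalIntegrable_clm_comp hw hT)

theorem firstOrderState_mem_L2e {w : ℝ → W} (hw : w ∈ L2e W) : firstOrderState α B w ∈ L2e E :=
  L2e.of_continuousOn fun _ hT => continuousOn_firstOrderState hw hT

theorem isCausal_firstOrderOperator : IsCausal (firstOrderOperator α A B D) := by
  refine ⟨fun w hw => L2e.add (L2e.clm_comp A (firstOrderState_mem_L2e hw)) (L2e.clm_comp D hw),
    fun T _ w _ w' _ h => ?_⟩
  have hstate : EqOn (firstOrderState α B w) (firstOrderState α B w') (Icc 0 T) :=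
    expConv_congr (h.fun_comp B)
  filter_upwards [h, ae_restrict_mem measurableSet_Icc] with t ht htT
  simp only [firstOrderOperator, hstate htT, ht]

end FirstOrderOperator

section FeedbackLoop

variable {E V W : Type*} [NormedAddCommGroup E] [NormedAddCommGroup V] [NormedAddCommGroup W]
  {N : V → W} {S : V × W × E → V} {KN KS : ℝ≥0}

theorem isCausal_pointwise (hN : LipschitzWith KN N) (hN0 : N 0 = 0) :
    IsCausal fun (v : ℝ → V) t => N (v t) :=
  ⟨fun _ hv => L2e.lipschitz_comp hN hN0 hv, fun _ _ _ _ _ _ h => h.fun_comp N⟩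

theorem exists_lipschitzWith_loopSignals (hN : LipschitzWith KN N) (hS : LipschitzWith KS S) :
    ∃ K > 0, LipschitzWith K fun p : V × W × E => (S p, N (S p) + p.2.1) := by
  have hsignals := hS.prodMk
    ((hN.comp hS).add (LipschitzWith.prod_fst.comp LipschitzWith.prod_snd (f := Prod.fst)))
  exact ⟨_ + 1, by positivity, hsignals.weaken le_self_add⟩

variable [NormedSpace ℝ E] [NormedSpace ℝ W] {α : ℝ} {B : W →L[ℝ] E}

/-- The right hand side of the state equation of the interconnection, in terms of the inputs and
the state `(g, e, y)`, once the algebraic loop has been solved by `S`. -/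
def loopField (α : ℝ) (B : W →L[ℝ] E) (N : V → W) (S : V × W × E → V) (p : V × W × E) : E :=
  -(α • p.2.2) + B (N (S p) + p.2.1)

theorem exists_lipschitzWith_loopField (hN : LipschitzWith KN N) (hS : LipschitzWith KS S) :
    ∃ K > 0, LipschitzWith K (loopField α B N S) := by
  have hstate : LipschitzWith _ fun p : V × W × E => α • p.2.2 :=
    (lipschitzWith_smul α).comp (LipschitzWith.prod_snd.comp LipschitzWith.prod_snd)
  have hw : LipschitzWith _ fun p => N (S p) + p.2.1 :=
    (hN.comp hS).add (LipschitzWith.prod_fst.comp LipschitzWith.prod_snd)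
  have hfield := hstate.neg.add (B.lipschitz.comp hw)
  exact ⟨_ + 1, by positivity, hfield.weaken le_self_add⟩

theorem loopField_zero (hN0 : N 0 = 0) (hS0 : S 0 = 0) : loopField α B N S 0 = 0 := by
  simp [loopField, hN0, hS0]

theorem loopField_mem_L2e (hN : LipschitzWith KN N) (hN0 : N 0 = 0) (hS : LipschitzWith KS S)
    (hS0 : S 0 = 0) {g : ℝ → V} {e : ℝ → W} {y : ℝ → E} (hg : g ∈ L2e V) (he : e ∈ L2e W)
    (hy : y ∈ L2e E) : (fun t => loopField α B N S (g t, e t, y t)) ∈ L2e E := by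
  obtain ⟨K, -, hK⟩ := exists_lipschitzWith_loopField (α := α) (B := B) hN hS
  exact L2e.lipschitz_comp hK (loopField_zero hN0 hS0) (L2e.prodMk hg (L2e.prodMk he hy))

variable [NormedSpace ℝ V] {A : E →L[ℝ] V} {D : W →L[ℝ] V}

/-- `S (g, e, y)` is the only solution `v` of the algebraic loop `v = A y + D (N v + e) + g` of the
interconnection of `firstOrderOperator α A B D` with the pointwise nonlinearity `N`. -/
def SolvesLoop (A : E →L[ℝ] V) (D : W →L[ℝ] V) (N : V → W) (S : V × W × E → V) : Prop :=
  ∀ g e y v, v = A y + D (N v + e) + g ↔ v = S (g, e, y)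

section Interconnected

variable {g v : ℝ → V} {e w : ℝ → W}

theorem Interconnected.ae_eq_loop (hloop : SolvesLoop A D N S)
    (hvw : Interconnected (firstOrderOperator α A B D) (fun v t => N (v t)) e g v w) :
    ∀ᵐ t ∂volume.restrict (Ici 0), v t = S (g t, e t, firstOrderState α B w t) ∧
      w t = N (S (g t, e t, firstOrderState α B w t)) + e t := by
  filter_upwards [hvw.eq_v, hvw.eq_w] with t htv htw
  simp only [Pi.add_apply] at htv htw
  have hv : v t = S (g t, e t, firstOrderState α B w t) :=
    (hloop _ _ _ _).1 (by rw [← htw]; exact htv)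
  exact ⟨hv, hv ▸ htw⟩

theorem Interconnected.firstOrderState_eq_integral [CompleteSpace E] (hloop : SolvesLoop A D N S)
    (hvw : Interconnected (firstOrderOperator α A B D) (fun v t => N (v t)) e g v w) {t : ℝ}
    (ht : 0 ≤ t) : firstOrderState α B w t =
      ∫ s in (0 : ℝ)..t, loopField α B N S (g s, e s, firstOrderState α B w s) := by
  rw [firstOrderState, expConv_eq_integral ht (intervalIntegrable_clm_comp hvw.mem_w ht)]
  refine intervalIntegral.integral_congr_ae ?_
  filter_upwards [(ae_restrict_iff' measurableSet_Ici).1 (hvw.ae_eq_loop hloop)] with s hs hst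
  rw [uIoc_of_le ht] at hst
  rw [(hs hst.1.le).2]
  rfl

theorem Interconnected.agreeUpTo [CompleteSpace E] (hN : LipschitzWith KN N) (hN0 : N 0 = 0)
    (hS : LipschitzWith KS S) (hS0 : S 0 = 0) (hloop : SolvesLoop A D N S)
    {g' v' : ℝ → V} {e' w' : ℝ → W} {T : ℝ} (hg : g ∈ L2e V) (hg' : g' ∈ L2e V)
    (he : e ∈ L2e W) (he' : e' ∈ L2e W)
    (hvw : Interconnected (firstOrderOperator α A B D) (fun v t => N (v t)) e g v w)
    (hvw' : Interconnected (firstOrderOperator α A B D) (fun v t => N (v t)) e' g' v' w')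
    (hT : 0 ≤ T) (hee' : AgreeUpTo T e e') (hgg' : AgreeUpTo T g g') :
    AgreeUpTo T v v' ∧ AgreeUpTo T w w' := by
  obtain ⟨K, -, hK⟩ := exists_lipschitzWith_loopField (α := α) (B := B) hN hS
  have hint {g : ℝ → V} {e : ℝ → W} {w : ℝ → W} (hg : g ∈ L2e V) (he : e ∈ L2e W)
      (hw : w ∈ L2e W) := L2e.intervalIntegrable
    (loopField_mem_L2e (α := α) (B := B) hN hN0 hS hS0 hg he
      (firstOrderState_mem_L2e (α := α) (B := B) hw)) hT
  have hstate : ∀ t ∈ Icc 0 T, firstOrderState α B w t = firstOrderState α B w' t := by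
    refine eq_of_integral_eq (c := 0) (K := K) (continuousOn_firstOrderState hvw.mem_w hT)
      (continuousOn_firstOrderState hvw'.mem_w hT) (hint hg he hvw.mem_w)
      (hint hg' he' hvw'.mem_w)
      (fun t ht => (hvw.firstOrderState_eq_integral hloop ht.1).trans (zero_add _).symm)
      (fun t ht => (hvw'.firstOrderState_eq_integral hloop ht.1).trans (zero_add _).symm) ?_
    filter_upwards [hee', hgg'] with t hte htg
    rw [hte, htg]
    refine (hK.norm_sub_le _ _).trans_eq ?_
    simp [Prod.norm_def]
  have hIcc : Icc 0 T ⊆ Ici 0 := Icc_subset_Ici_self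
  have hloopT := ae_restrict_of_ae_restrict_of_subset hIcc (hvw.ae_eq_loop hloop)
  have hloopT' := ae_restrict_of_ae_restrict_of_subset hIcc (hvw'.ae_eq_loop hloop)
  constructor
  · filter_upwards [hloopT, hloopT', hee', hgg', ae_restrict_mem measurableSet_Icc]
      with t ht ht' hte htg htT
    rw [ht.1, ht'.1, hte, htg, hstate t htT]
  · filter_upwards [hloopT, hloopT', hee', hgg', ae_restrict_mem measurableSet_Icc]
      with t ht ht' hte htg htT
    rw [ht.2, ht'.2, hte, htg, hstate t htT]

theorem exists_interconnected [CompleteSpace E] (hN : LipschitzWith KN N) (hN0 : N 0 = 0)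
    (hS : LipschitzWith KS S) (hS0 : S 0 = 0) (hloop : SolvesLoop A D N S) (he : e ∈ L2e W)
    (hg : g ∈ L2e V) :
    ∃ v w, Interconnected (firstOrderOperator α A B D) (fun v t => N (v t)) e g v w := by
  obtain ⟨K, hK0, hK⟩ := exists_lipschitzWith_loopField (α := α) (B := B) hN hS
  obtain ⟨y, hy, hyint⟩ := exists_integral_eq (Φ := fun t x => loopField α B N S (g t, e t, x))
    (K := K) hK0 0
    (fun u hu T hT => L2e.intervalIntegrable (loopField_mem_L2e hN hN0 hS hS0 hg he
      (L2e.of_continuousOn fun T _ => hu.continuousOn)) hT)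
    (fun s x x' => (hK.norm_sub_le _ _).trans_eq (by simp [Prod.norm_def]))
  have hyL : y ∈ L2e E := L2e.of_continuousOn fun T _ => hy.continuousOn
  let v : ℝ → V := fun t => S (g t, e t, y t)
  let w : ℝ → W := fun t => N (v t) + e t
  have hv : v ∈ L2e V := L2e.lipschitz_comp hS hS0 (L2e.prodMk hg (L2e.prodMk he hyL))
  have hw : w ∈ L2e W := L2e.add (L2e.lipschitz_comp hN hN0 hv) he
  have hstate : ∀ t, 0 ≤ t → y t = firstOrderState α B w t := fun t ht =>
    eq_expConv (intervalIntegrable_clm_comp hw ht) hy.continuousOn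
      (fun s hs => (hyint s hs.1).trans (zero_add _)) (right_mem_Icc.2 ht)
  refine ⟨v, w, hv, hw, ?_, EventuallyEq.rfl⟩
  filter_upwards [ae_restrict_mem measurableSet_Ici] with t ht
  simp only [Pi.add_apply, firstOrderOperator, ← hstate t ht]
  exact (hloop _ _ _ _).2 rfl

end Interconnected

theorem wellPosed_firstOrderOperator [CompleteSpace E] (hN : LipschitzWith KN N) (hN0 : N 0 = 0)
    (hS : LipschitzWith KS S) (hS0 : S 0 = 0) (hloop : SolvesLoop A D N S) :
    WellPosed (firstOrderOperator α A B D) fun v t => N (v t) where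
  causal_G := isCausal_firstOrderOperator
  causal_Δ := isCausal_pointwise hN hN0
  exists_solution _ he _ hg := exists_interconnected hN hN0 hS hS0 hloop he hg
  causal_inverse _ hT _ he _ he' _ hg _ hg' _ _ _ _ hvw hvw' :=
    hvw.agreeUpTo hN hN0 hS hS0 hloop hg hg' he he' hvw' hT

end FeedbackLoop

section StorageFunction

variable {E V W : Type*} [NormedAddCommGroup E] [NormedAddCommGroup V] [NormedAddCommGroup W]
  {N : V → W} {S : V × W × E → V} {KN KS : ℝ≥0}

theorem norm_prodMk_sq_le (v : V) (w : W) : ‖(v, w)‖ ^ 2 ≤ ‖v‖ ^ 2 + ‖w‖ ^ 2 := by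
  rcases max_choice ‖v‖ ‖w‖ with h | h <;>
    · rw [Prod.norm_mk, h]
      nlinarith [sq_nonneg ‖v‖, sq_nonneg ‖w‖]

theorem exists_loopSignals_norm_sq_le (hN : LipschitzWith KN N) (hN0 : N 0 = 0)
    (hS : LipschitzWith KS S) (hS0 : S 0 = 0) :
    ∃ C, 0 < C ∧ ∀ (g : V) (e : W) (y : E), ‖S (g, e, y)‖ ^ 2 + ‖N (S (g, e, y)) + e‖ ^ 2 ≤
      C * (‖g‖ ^ 2 + ‖e‖ ^ 2 + ‖y‖ ^ 2) := by
  obtain ⟨K, hK0, hK⟩ := exists_lipschitzWith_loopSignals hN hS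
  refine ⟨2 * K ^ 2, by positivity, fun g e y => ?_⟩
  have hle : ‖(S (g, e, y), N (S (g, e, y)) + e)‖ ≤ K * ‖(g, e, y)‖ :=
    hK.norm_le_mul (by simp [hN0, hS0]) _
  have hv := pow_le_pow_left₀ (norm_nonneg _) ((norm_fst_le _).trans hle) 2
  have hw := pow_le_pow_left₀ (norm_nonneg _) ((norm_snd_le _).trans hle) 2
  rw [mul_pow] at hv hw
  have hnorm : ‖(g, e, y)‖ ^ 2 ≤ ‖g‖ ^ 2 + ‖e‖ ^ 2 + ‖y‖ ^ 2 := by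
    linarith [norm_prodMk_sq_le g (e, y), norm_prodMk_sq_le e y]
  have := mul_le_mul_of_nonneg_left hnorm (sq_nonneg (K : ℝ))
  linarith

variable [NormedSpace ℝ E] [NormedSpace ℝ W] {α δ M : ℝ} {B : W →L[ℝ] E} {U : E → ℝ}

theorem exists_dissipation_of_lyapunov (hN : LipschitzWith KN N) (hS : LipschitzWith KS S)
    (hδ : 0 < δ) (hM : ∀ y, ‖fderiv ℝ U y‖ ≤ M * ‖y‖)
    (hU : ∀ y, fderiv ℝ U y (loopField α B N S (0, 0, y)) ≤ -δ * ‖y‖ ^ 2) :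
    ∃ C, 0 ≤ C ∧ ∀ g e y, fderiv ℝ U y (loopField α B N S (g, e, y)) ≤
      C * (‖g‖ ^ 2 + ‖e‖ ^ 2) - δ / 2 * ‖y‖ ^ 2 := by
  obtain ⟨K, -, hK⟩ := exists_lipschitzWith_loopField (α := α) (B := B) hN hS
  refine ⟨(M * K) ^ 2 / (2 * δ), by positivity, fun g e y => ?_⟩
  let r := loopField α B N S (g, e, y) - loopField α B N S (0, 0, y)
  have hr : ‖r‖ ≤ K * ‖(g, e)‖ := by
    refine (hK.norm_sub_le _ _).trans_eq ?_
    simp [Prod.norm_def]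
  have hinput : fderiv ℝ U y r ≤ ‖y‖ * (M * K * ‖(g, e)‖) := calc
    fderiv ℝ U y r ≤ ‖fderiv ℝ U y‖ * ‖r‖ :=
      (le_abs_self _).trans ((fderiv ℝ U y).le_opNorm r)
    _ ≤ M * ‖y‖ * (K * ‖(g, e)‖) :=
      mul_le_mul (hM y) hr (norm_nonneg _) ((norm_nonneg _).trans (hM y))
    _ = ‖y‖ * (M * K * ‖(g, e)‖) := by ring
  have hyoung : ‖y‖ * (M * K * ‖(g, e)‖) ≤
      δ / 2 * ‖y‖ ^ 2 + (M * K) ^ 2 / (2 * δ) * ‖(g, e)‖ ^ 2 := by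
    have := div_nonneg (sq_nonneg (δ * ‖y‖ - M * K * ‖(g, e)‖)) (by positivity : 0 ≤ 2 * δ)
    refine sub_nonneg.1 (this.trans_eq ?_)
    field_simp
    ring
  have hsplit : fderiv ℝ U y (loopField α B N S (g, e, y)) =
      fderiv ℝ U y (loopField α B N S (0, 0, y)) + fderiv ℝ U y r := by
    rw [← map_add, add_sub_cancel]
  have hnorm := mul_le_mul_of_nonneg_left (norm_prodMk_sq_le g e)
    (by positivity : 0 ≤ (M * K) ^ 2 / (2 * δ))
  linarith [hU y]

variable [NormedSpace ℝ V] {A : E →L[ℝ] V} {D : W →L[ℝ] V}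

theorem Interconnected.integral_le_of_dissipation [CompleteSpace E] (hN : LipschitzWith KN N)
    (hN0 : N 0 = 0) (hS : LipschitzWith KS S) (hS0 : S 0 = 0) (hloop : SolvesLoop A D N S)
    (hU1 : ContDiff ℝ 1 U) (hU : ∀ y, 0 ≤ U y) (hU0 : U 0 = 0) {a b : ℝ}
    (hdiss : ∀ g e y, fderiv ℝ U y (loopField α B N S (g, e, y)) ≤
      b * (‖g‖ ^ 2 + ‖e‖ ^ 2) - a * (‖S (g, e, y)‖ ^ 2 + ‖N (S (g, e, y)) + e‖ ^ 2))
    {g v : ℝ → V} {e w : ℝ → W} (hg : g ∈ L2e V) (he : e ∈ L2e W)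
    (hvw : Interconnected (firstOrderOperator α A B D) (fun v t => N (v t)) e g v w)
    {T : ℝ} (hT : 0 ≤ T) :
    a * ∫ t in (0 : ℝ)..T, (‖v t‖ ^ 2 + ‖w t‖ ^ 2) ≤
      b * ∫ t in (0 : ℝ)..T, (‖g t‖ ^ 2 + ‖e t‖ ^ 2) := by
  have hstate {t : ℝ} (ht : 0 ≤ t) :
      firstOrderState α B w t = firstOrderState α B w 0 +
        ∫ s in (0 : ℝ)..t, loopField α B N S (g s, e s, firstOrderState α B w s) := by
    rw [hvw.firstOrderState_eq_integral hloop ht,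
      hvw.firstOrderState_eq_integral hloop le_rfl, intervalIntegral.integral_same, zero_add]
  have hinit : firstOrderState α B w 0 = 0 := by
    rw [hvw.firstOrderState_eq_integral hloop le_rfl, intervalIntegral.integral_same]
  have hIcc : Icc 0 T ⊆ Ici 0 := Icc_subset_Ici_self
  have := integral_le_add_integral_of_dissipation hT hU1 (hU (firstOrderState α B w T))
    (L2e.intervalIntegrable (loopField_mem_L2e hN hN0 hS hS0 hg he
      (firstOrderState_mem_L2e hvw.mem_w)) hT) (fun t ht => hstate ht.1)
    (((L2e.intervalIntegrable_norm_sq hvw.mem_v hT).add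
      (L2e.intervalIntegrable_norm_sq hvw.mem_w hT)).const_mul a)
    (((L2e.intervalIntegrable_norm_sq hg hT).add
      (L2e.intervalIntegrable_norm_sq he hT)).const_mul b) (by
    filter_upwards [ae_restrict_of_ae_restrict_of_subset hIcc (hvw.ae_eq_loop hloop)] with t ht
    rw [ht.1, ht.2]
    exact hdiss _ _ _)
  simpa only [hinit, hU0, zero_add, intervalIntegral.integral_const_mul] using this

theorem isStable_firstOrderOperator_of_lyapunov [CompleteSpace E] (hN : LipschitzWith KN N)
    (hN0 : N 0 = 0) (hS : LipschitzWith KS S) (hS0 : S 0 = 0) (hloop : SolvesLoop A D N S)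
    (hU1 : ContDiff ℝ 1 U) (hUnonneg : ∀ y, 0 ≤ U y) (hU0 : U 0 = 0) (hδ : 0 < δ)
    (hM : ∀ y, ‖fderiv ℝ U y‖ ≤ M * ‖y‖)
    (hU : ∀ y, fderiv ℝ U y (loopField α B N S (0, 0, y)) ≤ -δ * ‖y‖ ^ 2) :
    IsStable (firstOrderOperator α A B D) fun v t => N (v t) := by
  obtain ⟨C, hC, hdiss⟩ := exists_dissipation_of_lyapunov hN hS hδ hM hU
  obtain ⟨K, hK, hsignals⟩ := exists_loopSignals_norm_sq_le hN hN0 hS hS0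
  have hdissOut (g : V) (e : W) (y : E) : fderiv ℝ U y (loopField α B N S (g, e, y)) ≤
      (C + δ / 2) * (‖g‖ ^ 2 + ‖e‖ ^ 2) -
        δ / (2 * K) * (‖S (g, e, y)‖ ^ 2 + ‖N (S (g, e, y)) + e‖ ^ 2) := by
    have := mul_le_mul_of_nonneg_left (hsignals g e y) (by positivity : 0 ≤ δ / (2 * K))
    rw [← mul_assoc, show δ / (2 * K) * K = δ / 2 by field_simp] at this
    linarith [hdiss g e y]
  refine ⟨wellPosed_firstOrderOperator hN hN0 hS hS0 hloop,
    (C + δ / 2) / (δ / (2 * K)), by positivity, fun e he g hg v w hvw T hT => ?_⟩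
  rw [div_mul_eq_mul_div, le_div_iff₀' (by positivity)]
  exact hvw.integral_le_of_dissipation hN hN0 hS hS0 hloop hU1 hUnonneg hU0 hdissOut hg he hT

end StorageFunction

section MatrixRealization

variable {n m l : Type*} [Fintype n] [Fintype m] [Fintype l]

/-- The continuous linear map between Euclidean spaces given by a matrix. -/
noncomputable def euclideanCLM [DecidableEq m] (M : Matrix l m ℝ) :
    EuclideanSpace ℝ m →L[ℝ] EuclideanSpace ℝ l :=
  (Matrix.toLpLin 2 2 M).toContinuousLinearMap

theorem exp_smul_neg_smul_one [DecidableEq n] (α r : ℝ) :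
    NormedSpace.exp (r • (-α) • (1 : Matrix n n ℝ)) = Real.exp (-(α * r)) • 1 := by
  rw [smul_smul, Matrix.smul_one_eq_diagonal, Matrix.exp_diagonal, Matrix.smul_one_eq_diagonal]
  congr 1
  funext i
  rw [Pi.coe_exp, Real.exp_eq_exp_ℝ]
  ring_nf

theorem ltiOperator_eq_firstOrderOperator [DecidableEq n] [DecidableEq m] (α : ℝ) {B : Matrix n m ℝ}
    {C : Matrix l n ℝ} {D : Matrix l m ℝ} (hC : Function.Injective C.mulVec) :
    ltiOperator ((-α) • 1) B C D =
      firstOrderOperator α (euclideanCLM C) (euclideanCLM B) (euclideanCLM D) := by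
  funext w t
  let A : EuclideanSpace ℝ n →L[ℝ] (l → ℝ) :=
    (PiLp.continuousLinearEquiv 2 ℝ fun _ : l => ℝ).toContinuousLinearMap ∘L euclideanCLM C
  have hker : LinearMap.ker A.toLinearMap = ⊥ :=
    LinearMap.ker_eq_bot.2 fun x y h => PiLp.ext fun i => congrFun (hC h) i
  obtain ⟨K, -, hK⟩ := A.toLinearMap.exists_antilipschitzWith hker
  have hkernel (s : ℝ) :
      (C * NormedSpace.exp ((t - s) • (-α) • (1 : Matrix n n ℝ)) * B).mulVec (w s).ofLp =
        A (Real.exp (-(α * (t - s))) • euclideanCLM B (w s)) := by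
    rw [exp_smul_neg_smul_one, Matrix.mul_smul, Matrix.mul_one, Matrix.smul_mul,
      Matrix.smul_mulVec, ← Matrix.mulVec_mulVec, map_smul]
    rfl
  simp only [ltiOperator, hkernel, intervalIntegral]
  rw [A.integral_comp_comm' hK, A.integral_comp_comm' hK, ← map_sub]
  rfl

end MatrixRealization

section Stacked

variable {d : ℕ}

/-- `stack` as a linear homeomorphism, with inverse `v ↦ (upper v, lower v)`. -/
noncomputable def stackEquiv (d : ℕ) : (Vec d × Vec d) ≃L[ℝ] Vec2 d :=
  LinearEquiv.toContinuousLinearEquiv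
    { toFun := fun p => stack p.1 p.2
      invFun := fun v => (upper v, lower v)
      map_add' := fun p q => by ext (i | i) <;> rfl
      map_smul' := fun c p => by ext (i | i) <;> rfl
      left_inv := fun _ => rfl
      right_inv := fun v => by ext (i | i) <;> rfl }

theorem stackEquiv_apply (p : Vec d × Vec d) : stackEquiv d p = stack p.1 p.2 := rfl

theorem stackEquiv_symm_apply (v : Vec2 d) : (stackEquiv d).symm v = (upper v, lower v) := rfl

@[simp]
theorem upper_stack (a b : Vec d) : upper (stack a b) = a := rfl

@[simp]
theorem lower_stack (a b : Vec d) : lower (stack a b) = b := rfl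

@[simp]
theorem upper_zero : upper (0 : Vec2 d) = 0 := rfl

@[simp]
theorem lower_zero : lower (0 : Vec2 d) = 0 := rfl

@[simp]
theorem stack_zero_zero : stack (0 : Vec d) 0 = 0 := map_zero (stackEquiv d)

theorem eq_stack_iff {v : Vec2 d} {a b : Vec d} : v = stack a b ↔ upper v = a ∧ lower v = b := by
  rw [← stackEquiv_apply (a, b), ← ContinuousLinearEquiv.symm_apply_eq, stackEquiv_symm_apply,
    Prod.mk.injEq]

theorem exists_lipschitzWith_stack {X : Type*} [PseudoEMetricSpace X] {a b : X → Vec d}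
    {Ka Kb : ℝ≥0} (ha : LipschitzWith Ka a) (hb : LipschitzWith Kb b) :
    ∃ K, LipschitzWith K fun p => stack (a p) (b p) := by
  have h := (stackEquiv d).lipschitz.comp (ha.prodMk hb)
  exact ⟨_, h⟩

theorem exists_lipschitzWith_upper (d : ℕ) : ∃ K, LipschitzWith K (upper (d := d)) := by
  have h := LipschitzWith.prod_fst.comp (stackEquiv d).symm.lipschitz
  exact ⟨_, h⟩

theorem exists_lipschitzWith_lower (d : ℕ) : ∃ K, LipschitzWith K (lower (d := d)) := by
  have h := LipschitzWith.prod_snd.comp (stackEquiv d).symm.lipschitz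
  exact ⟨_, h⟩

end Stacked

section MirrorDescentLoop

variable {d : ℕ} {η μf μc : ℝ}

theorem mdOperator_eq_firstOrderOperator : mdOperator d η μf μc =
    firstOrderOperator (η * μf * μc) (euclideanCLM (matC d μc)) (euclideanCLM (matB d η μf))
      (euclideanCLM (matD d)) := by
  refine ltiOperator_eq_firstOrderOperator _ fun x y h => funext fun i => ?_
  simpa [matC, Matrix.fromRows_mulVec] using congrFun h (Sum.inr i)

theorem euclideanCLM_matB (w : Vec2 d) :
    euclideanCLM (matB d η μf) w = -(η • (upper w + μf • lower w)) := by
  ext i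
  simp only [euclideanCLM, matB, neg_smul, LinearMap.coe_toContinuousLinearMap',
    Matrix.ofLp_toLpLin, Matrix.toLin'_apply, Matrix.fromCols_mulVec, Function.comp_def,
    Matrix.neg_mulVec, Matrix.smul_mulVec, Matrix.one_mulVec, Pi.add_apply, Pi.neg_apply,
    Pi.smul_apply, smul_eq_mul, upper, lower, smul_add, neg_add_rev, PiLp.add_apply,
    PiLp.neg_apply, PiLp.smul_apply]
  ring

theorem euclideanCLM_matC (y : Vec d) : euclideanCLM (matC d μc) y = stack (μc • y) y := by
  ext (i | i) <;> simp [euclideanCLM, matC, Matrix.fromRows_mulVec, Matrix.smul_mulVec, stack]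

theorem euclideanCLM_matD (w : Vec2 d) : euclideanCLM (matD d) w = stack (lower w) 0 := by
  ext (i | i) <;>
    simp [euclideanCLM, matD, Matrix.fromBlocks_mulVec, stack, lower, Function.comp_def]

/-- The block diagonal map `diag(N₁, N₂)` on stacked vectors. -/
noncomputable def blockDiag (N₁ N₂ : Vec d → Vec d) (v : Vec2 d) : Vec2 d :=
  stack (N₁ (upper v)) (N₂ (lower v))

/-- The solution `v` of the algebraic loop `v = C y + D (diag(N₁, N₂) v + e) + g`. Since `D` feeds
only the lower half of `w` into the upper half of `v`, the loop is triangular. -/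
noncomputable def mdLoopSolution (μc : ℝ) (N₂ : Vec d → Vec d)
    (p : Vec2 d × Vec2 d × Vec d) : Vec2 d :=
  stack (μc • p.2.2 + (N₂ (p.2.2 + lower p.1) + lower p.2.1) + upper p.1) (p.2.2 + lower p.1)

variable {N₁ N₂ : Vec d → Vec d} {K₁ K₂ : ℝ≥0}

theorem solvesLoop_mdLoopSolution : SolvesLoop (euclideanCLM (matC d μc)) (euclideanCLM (matD d))
    (blockDiag N₁ N₂) (mdLoopSolution μc N₂) := by
  intro g e y v
  have hsum : euclideanCLM (matC d μc) y + euclideanCLM (matD d) (blockDiag N₁ N₂ v + e) + g =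
      stack (μc • y + (N₂ (lower v) + lower e) + upper g) (y + lower g) := by
    rw [euclideanCLM_matC, euclideanCLM_matD, eq_stack_iff]
    exact ⟨rfl, congrArg (· + lower g) (add_zero y)⟩
  rw [hsum, mdLoopSolution, eq_stack_iff, eq_stack_iff]
  refine and_congr_left fun hlower => ?_
  rw [hlower]

theorem exists_lipschitzWith_blockDiag (hN₁ : LipschitzWith K₁ N₁) (hN₂ : LipschitzWith K₂ N₂) :
    ∃ K, LipschitzWith K (blockDiag N₁ N₂) := by
  obtain ⟨_, hupper⟩ := exists_lipschitzWith_upper d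
  obtain ⟨_, hlower⟩ := exists_lipschitzWith_lower d
  exact exists_lipschitzWith_stack (hN₁.comp hupper) (hN₂.comp hlower)

theorem exists_lipschitzWith_mdLoopSolution (hN₂ : LipschitzWith K₂ N₂) :
    ∃ K, LipschitzWith K (mdLoopSolution μc N₂) := by
  obtain ⟨_, hupper⟩ := exists_lipschitzWith_upper d
  obtain ⟨_, hlower⟩ := exists_lipschitzWith_lower d
  have hg : LipschitzWith _ fun p : Vec2 d × Vec2 d × Vec d => p.1 := LipschitzWith.prod_fst
  have he : LipschitzWith _ fun p : Vec2 d × Vec2 d × Vec d => p.2.1 :=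
    LipschitzWith.prod_fst.comp LipschitzWith.prod_snd
  have hy : LipschitzWith _ fun p : Vec2 d × Vec2 d × Vec d => p.2.2 :=
    LipschitzWith.prod_snd.comp LipschitzWith.prod_snd
  have hv := hy.add (hlower.comp hg)
  exact exists_lipschitzWith_stack
    ((((lipschitzWith_smul μc).comp hy).add ((hN₂.comp hv).add (hlower.comp he))).add
      (hupper.comp hg)) hv

theorem blockDiag_zero (hN₁ : N₁ 0 = 0) (hN₂ : N₂ 0 = 0) : blockDiag N₁ N₂ 0 = 0 := by
  simp [blockDiag, hN₁, hN₂]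

theorem mdLoopSolution_zero (hN₂ : N₂ 0 = 0) : mdLoopSolution μc N₂ 0 = 0 := by
  simp [mdLoopSolution, hN₂]

theorem exists_lipschitzWith_shiftedGradient {h : Vec d → ℝ} {K : ℝ≥0}
    (hh : LipschitzWith K (∇ h)) (μ : ℝ) (y : Vec d) :
    ∃ K, LipschitzWith K (shiftedGradient h μ y) := by
  have hshift : LipschitzWith _ fun x : Vec d => x + y := LipschitzWith.id.add (.const y)
  have := ((hh.comp hshift).sub ((lipschitzWith_smul μ).comp hshift)).sub
    (.const (∇ h y - μ • y))
  exact ⟨_, this⟩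

theorem shiftedGradient_eq (h : Vec d → ℝ) (μ : ℝ) (y x : Vec d) :
    shiftedGradient h μ y x = (∇ h (x + y) - ∇ h y) - μ • x := by
  rw [shiftedGradient]
  module

theorem shiftedGradient_zero (h : Vec d → ℝ) (μ : ℝ) (y : Vec d) :
    shiftedGradient h μ y 0 = 0 := by
  simp [shiftedGradient]

-- Undoing the loop shifts turns the unforced loop back into the error dynamics of the flow.
theorem loopField_shiftedGradient (f ψ : Vec d → ℝ) (x z y : Vec d) :
    loopField (η * μf * μc) (euclideanCLM (matB d η μf))
      (blockDiag (shiftedGradient f μf x) (shiftedGradient ψ μc z))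
      (mdLoopSolution μc (shiftedGradient ψ μc z)) (0, 0, y) =
      -(η • (∇ f (∇ ψ (y + z) - ∇ ψ z + x) - ∇ f x)) := by
  have hloop : mdLoopSolution μc (shiftedGradient ψ μc z) (0, 0, y) =
      stack (∇ ψ (y + z) - ∇ ψ z) y := by
    simp [mdLoopSolution, shiftedGradient_eq]
  simp only [loopField, hloop, euclideanCLM_matB, blockDiag, add_zero, upper_stack, lower_stack,
    shiftedGradient_eq]
  module

theorem hasFDerivAt_bregmanDiv_add {h : Vec d → ℝ} (hh : Differentiable ℝ h) (z y : Vec d) :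
    HasFDerivAt (fun y => bregmanDiv h (y + z) z) (innerSL ℝ (∇ h (y + z) - ∇ h z)) y :=
  (hasFDerivAt_comp_add_right z).2 (hasGradientAt_bregmanDiv hh (y + z) z).hasFDerivAt

theorem contDiff_bregmanDiv_add {h : Vec d → ℝ} (hh : ContDiff ℝ 1 h) (z : Vec d) :
    ContDiff ℝ 1 fun y => bregmanDiv h (y + z) z := by
  have hshift : ContDiff ℝ 1 fun y : Vec d => y + z := contDiff_id.add contDiff_const
  exact ((hh.comp hshift).sub contDiff_const).sub
    (contDiff_const.inner ℝ (hshift.sub contDiff_const))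

theorem isStable_md {Lf Lc : ℝ} (hη : 0 < η) (hμf : 0 < μf) (hLf : 0 < Lf) (hμc : 0 < μc)
    (hLc : 0 < Lc) {f ψ : Vec d → ℝ} (hf : f ∈ classS μf Lf) (hψ : ψ ∈ classS μc Lc)
    (x z : Vec d) : IsStable (mdOperator d η μf μc) (mdNonlinearity f ψ μf μc x z) := by
  obtain ⟨_, hN₁⟩ := exists_lipschitzWith_shiftedGradient
    (classS.lipschitzWith_gradient hf hμf.le hLf) μf x
  have hψlip := classS.lipschitzWith_gradient hψ hμc.le hLc
  obtain ⟨_, hN₂⟩ := exists_lipschitzWith_shiftedGradient hψlip μc z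
  obtain ⟨_, hN⟩ := exists_lipschitzWith_blockDiag hN₁ hN₂
  obtain ⟨_, hS⟩ := exists_lipschitzWith_mdLoopSolution (μc := μc) hN₂
  have hψdiff := classS.differentiable hψ
  have hψmono := classS.isStronglyMonotone hψ
  have hfderiv (y : Vec d) := (hasFDerivAt_bregmanDiv_add hψdiff z y).fderiv
  have hle (y : Vec d) : ‖∇ ψ (y + z) - ∇ ψ z‖ ≤ Lc.toNNReal * ‖y‖ := by
    simpa only [add_sub_cancel_right] using hψlip.norm_sub_le (y + z) z
  have hge (y : Vec d) : μc * ‖y‖ ≤ ‖∇ ψ (y + z) - ∇ ψ z‖ := by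
    simpa only [add_sub_cancel_right] using hψmono.mul_norm_sub_le (y + z) z
  rw [mdOperator_eq_firstOrderOperator]
  refine isStable_firstOrderOperator_of_lyapunov hN
    (blockDiag_zero (shiftedGradient_zero _ _ _) (shiftedGradient_zero _ _ _)) hS
    (mdLoopSolution_zero (shiftedGradient_zero _ _ _)) solvesLoop_mdLoopSolution
    (M := Lc.toNNReal) (contDiff_bregmanDiv_add hψ.1 z)
    (fun y => bregmanDiv_nonneg hψdiff (hψmono.monotone hμc.le) _ _)
    (by rw [zero_add, bregmanDiv_self]) (by positivity : 0 < η * μf * μc ^ 2)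
    (fun y => ?_) fun y => ?_
  · rw [hfderiv, innerSL_apply_norm]
    exact hle y
  · rw [hfderiv, loopField_shiftedGradient, innerSL_apply_apply]
    calc ⟪∇ ψ (y + z) - ∇ ψ z, -(η • (∇ f (∇ ψ (y + z) - ∇ ψ z + x) - ∇ f x))⟫
        ≤ -(η * μf) * ‖∇ ψ (y + z) - ∇ ψ z‖ ^ 2 :=
          (classS.isStronglyMonotone hf).inner_neg_smul_sub_le hη.le _ x
      _ ≤ -(η * μf) * (μc * ‖y‖) ^ 2 :=
          mul_le_mul_of_nonpos_left (by gcongr; exact hge y) (neg_nonpos.2 (by positivity))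
      _ = -(η * μf * μc ^ 2) * ‖y‖ ^ 2 := by ring

end MirrorDescentLoop

section Trajectories

theorem le_exp_mul_of_hasDerivWithinAt_le {V V' : ℝ → ℝ} {k : ℝ}
    (hV : ∀ t, 0 ≤ t → HasDerivWithinAt V (V' t) (Ici 0) t)
    (hle : ∀ t, 0 ≤ t → V' t ≤ -k * V t) {t : ℝ} (ht : 0 ≤ t) :
    V t ≤ Real.exp (-(k * t)) * V 0 := by
  have hderiv (t : ℝ) (ht : 0 ≤ t) : HasDerivWithinAt (fun t => Real.exp (k * t) * V t)
      (Real.exp (k * t) * (k * V t + V' t)) (Ici 0) t := by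
    convert! ((hasDerivAt_id t).const_mul k).exp.hasDerivWithinAt.mul (hV t ht) using 1
    simp only [id_eq]
    ring
  have hanti : AntitoneOn (fun t => Real.exp (k * t) * V t) (Ici 0) :=
    antitoneOn_of_hasDerivWithinAt_nonpos (convex_Ici 0)
      (fun t ht => (hderiv t ht).continuousWithinAt)
      (fun t ht => (hderiv t (interior_subset ht)).mono interior_subset) fun t ht =>
      mul_nonpos_of_nonneg_of_nonpos (Real.exp_pos _).le (by linarith [hle t (interior_subset ht)])
  have h0 := hanti self_mem_Ici (mem_Ici.2 ht) ht
  simp only [mul_zero, Real.exp_zero, one_mul] at h0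
  rwa [Real.exp_neg, ← div_eq_inv_mul, le_div_iff₀' (Real.exp_pos _)]

variable {E : Type*} [NormedAddCommGroup E] [InnerProductSpace ℝ E] [CompleteSpace E]
  {η μf μc L : ℝ} {f ψ : E → ℝ}

theorem bregmanDiv_le_exp_mul_of_flow (hη : 0 ≤ η) (hμf : 0 ≤ μf) (hμc : 0 ≤ μc)
    (hf : IsStronglyMonotone μf (∇ f)) (hψdiff : Differentiable ℝ ψ)
    (hψ : IsStronglyMonotone μc (∇ ψ)) {zopt : E} (hzopt : ∇ f (∇ ψ zopt) = 0) {z : ℝ → E}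
    (hz : ∀ t, 0 ≤ t → HasDerivWithinAt z (-η • ∇ f (∇ ψ (z t))) (Ici 0) t) {t : ℝ}
    (ht : 0 ≤ t) :
    bregmanDiv ψ (z t) zopt ≤ Real.exp (-(η * μf * μc * t)) * bregmanDiv ψ (z 0) zopt := by
  refine le_exp_mul_of_hasDerivWithinAt_le (V := fun t => bregmanDiv ψ (z t) zopt)
    (fun t ht => (hasGradientAt_bregmanDiv hψdiff (z t) zopt).hasFDerivAt.comp_hasDerivWithinAt t
      (hz t ht)) (fun t _ => ?_) ht
  have hflow := hf.inner_neg_smul_sub_le hη (∇ ψ (z t) - ∇ ψ zopt) (∇ ψ zopt)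
  rw [sub_add_cancel, hzopt, sub_zero, ← neg_smul] at hflow
  calc ⟪∇ ψ (z t) - ∇ ψ zopt, -η • ∇ f (∇ ψ (z t))⟫
      ≤ -(η * μf) * ‖∇ ψ (z t) - ∇ ψ zopt‖ ^ 2 := hflow
    _ ≤ -(η * μf) * (μc * bregmanDiv ψ (z t) zopt) :=
        mul_le_mul_of_nonpos_left (mul_bregmanDiv_le_norm_gradient_sub_sq hψdiff hμc hψ _ _)
          (neg_nonpos.2 (by positivity))
    _ = -(η * μf * μc) * bregmanDiv ψ (z t) zopt := by ring

theorem tendsto_gradient_of_flow (hη : 0 < η) (hμf : 0 < μf) (hμc : 0 < μc) (hL : 0 < L)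
    (hf : IsStronglyMonotone μf (∇ f)) (hψdiff : Differentiable ℝ ψ)
    (hψ : IsStronglyMonotone μc (∇ ψ)) (hψL : IsOneSidedLipschitz L (∇ ψ)) {zopt : E}
    (hzopt : ∇ f (∇ ψ zopt) = 0) {z : ℝ → E}
    (hz : ∀ t, 0 ≤ t → HasDerivWithinAt z (-η • ∇ f (∇ ψ (z t))) (Ici 0) t) :
    Tendsto (fun t => ∇ ψ (z t)) atTop (𝓝 (∇ ψ zopt)) := by
  let k : ℝ := η * μf * μc
  have hk : 0 < k := by positivity
  have hexp : Tendsto (fun t => 2 * L * (Real.exp (-(k * t)) * bregmanDiv ψ (z 0) zopt))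
      atTop (𝓝 0) := by
    have := Real.tendsto_exp_neg_atTop_nhds_zero.comp (tendsto_id.const_mul_atTop hk)
    simpa using (this.mul_const (bregmanDiv ψ (z 0) zopt)).const_mul (2 * L)
  have hsq : Tendsto (fun t => ‖∇ ψ (z t) - ∇ ψ zopt‖ ^ 2) atTop (𝓝 0) := by
    refine squeeze_zero' (Eventually.of_forall fun t => sq_nonneg _) ?_ hexp
    filter_upwards [eventually_ge_atTop 0] with t ht
    refine (norm_gradient_sub_sq_le_bregmanDiv hL hψdiff (hψ.monotone hμc.le) hψL _ _).trans ?_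
    gcongr
    exact bregmanDiv_le_exp_mul_of_flow hη.le hμf.le hμc.le hf hψdiff hψ hzopt hz ht
  rw [tendsto_iff_norm_sub_tendsto_zero]
  simpa [Real.sqrt_sq] using hsq.sqrt

end Trajectories

end MirrorDescent

open MirrorDescent in
theorem theorem2 (d : ℕ) (η μf Lf μφ Lφ : ℝ) (hη : 0 < η)
    (hμf : 0 < μf) (hLf : μf ≤ Lf) (hμφ : 0 < μφ) (hLφ : μφ ≤ Lφ)
    (f φ : Vec d → ℝ) (hf : f ∈ classS μf Lf) (hφ : φ ∈ classS μφ Lφ) :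
    ∃ xopt zopt : Vec d,
      -- `xopt` is the unique minimizer of `f`
      (∀ x : Vec d, (∀ y : Vec d, f x ≤ f y) ↔ x = xopt) ∧
      -- `zopt` is the unique equilibrium of the flow, and it corresponds to `xopt`
      (∀ z : Vec d, gradient f (gradient (conjugate φ) z) = 0 ↔ z = zopt) ∧
      gradient (conjugate φ) zopt = xopt ∧
      -- the interconnection is stable, and its signals are in `L₂` for inputs in `L₂`
      IsStable (mdOperator d η μf Lφ⁻¹) (mdNonlinearity f (conjugate φ) μf Lφ⁻¹ xopt zopt) ∧
      (∀ e ∈ L2 (Vec2 d), ∀ g ∈ L2 (Vec2 d), ∀ v w : ℝ → Vec2 d,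
        Interconnected (mdOperator d η μf Lφ⁻¹)
          (mdNonlinearity f (conjugate φ) μf Lφ⁻¹ xopt zopt) e g v w →
        v ∈ L2 (Vec2 d) ∧ w ∈ L2 (Vec2 d)) ∧
      -- every initial condition has a trajectory, and along every trajectory `x` converges
      (∀ z₀ : Vec d, ∃ z : ℝ → Vec d, IsMDTrajectory η f (conjugate φ) z ∧ z 0 = z₀) ∧
      (∀ z : ℝ → Vec d, IsMDTrajectory η f (conjugate φ) z →
        Tendsto (fun t => gradient (conjugate φ) (z t)) atTop (𝓝 xopt)) := by
  have hLf0 : 0 < Lf := hμf.trans_le hLf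
  have hLφ0 : 0 < Lφ := hμφ.trans_le hLφ
  have hfmono := classS.isStronglyMonotone hf
  have hφdiff := classS.differentiable hφ
  have hφmono := classS.isStronglyMonotone hφ
  have hψ := classS.conjugate_mem hφ hμφ hLφ0
  obtain ⟨xopt, hx⟩ := surjective_gradient hμf (classS.differentiable hf) hfmono 0
  have hgrad (x : Vec d) : gradient f x = 0 ↔ x = xopt := by
    rw [← hx, (hfmono.injective hμf).eq_iff]
  have hz := gradient_conjugate_gradient hφdiff hμφ hφmono xopt
  have hstable := isStable_md hη hμf hLf0 (inv_pos.2 hLφ0) (inv_pos.2 hμφ) hf hψ xopt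
    (gradient φ xopt)
  have hflow := (lipschitzWith_smul (-η)).comp <|
    (classS.lipschitzWith_gradient hf hμf.le hLf0).comp
      (classS.lipschitzWith_gradient hψ (inv_nonneg.2 hLφ0.le) (inv_pos.2 hμφ))
  refine ⟨xopt, gradient φ xopt, fun x => ?_, fun z => ?_, hz, hstable,
    fun e he g hg v w hvw => hstable.mem_L2 he hg hvw,
    exists_hasDerivWithinAt_of_lipschitzWith hflow, fun z hzflow => ?_⟩
  · exact (forall_le_iff_gradient_eq_zero (classS.differentiable hf) (hfmono.monotone hμf.le)
      x).trans (hgrad x)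
  · exact (hgrad _).trans (gradient_conjugate_eq_iff hφdiff hμφ hφmono)
  · have hlim := tendsto_gradient_of_flow hη hμf (inv_pos.2 hLφ0) (inv_pos.2 hμφ) hfmono
      (classS.differentiable hψ) (classS.isStronglyMonotone hψ) (classS.isOneSidedLipschitz hψ)
      (hz.symm ▸ hx) hzflow
    rwa [hz] at hlim
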